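/- **Sequences and order.** Consider finite sequences $\alpha=(\alpha_1,\dots,\alpha_k)$ of positive integers, together with the special sequence $(0)$, of degree $0$, which is treated as the empty sequence in products. The degree is $D(\alpha)=\sum_i\alpha_i$. Put $Al(\alpha)=(\alpha_1,-\alpha_2,\alpha_3,-\alpha_4,\dots,0,0,\dots)$ and write $\alpha<\beta$ if the first nonzero term of $Al(\alpha)-Al(\beta)$ is negative. A sequence $\alpha$ is *lexical* if $\alpha>(\alpha_i,\dots,\alpha_k)$ for all $2\le i\le k$. Let $L_n$ be the set of lexical sequences with $1+D(\alpha)=n$ (so $L_1=\{(0)\}$), and let $D_n=\bigcup_{d\mid n}L_d$. In a set $S$, $\alpha\in S$ is *adjacent* to $\beta\in S$ if $\alpha<\beta$ and no $\gamma\in S$ satisfies $\alpha<\gamma<\beta$. **Operations.** Products of sequences are concatenations. The sequence $\alpha_e$ (resp. $\alpha_o$) is whichever of $(\alpha_1,\dots,\alpha_k+1)$ and $(\alpha_1,\dots,\alpha_k,1)$ has even (resp. odd) length; $(0)_o=(1)$. The harmonics of $\alpha$ are $h_0(\alpha)=\alpha$ and $h_j(\alpha)=(h_{j-1}(\alpha))_o\,h_{j-1}(\alpha)$.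 The star product is $\alpha\star\beta=\alpha_o(\alpha_e)^{\beta_1-1}\alpha_o(\alpha_e)^{\beta_2-1}\cdots\alpha_o(\alpha_e)^{\beta_k-1}\alpha$, with $(0)\star\beta=\beta$. For $\alpha\ne\beta$ in $L_n$, $\alpha\wedge\beta=(\alpha_1,\dots,\alpha_{i-1},\min(\alpha_i,\beta_i))$, where $i$ is the first place with $\alpha_i\neq\beta_i$. An elementary operation on a cell $\alpha_i$ with $i$ even (the tail of the left sequence $(\alpha_1,\dots,\alpha_i)$) replaces $\alpha_i$ by the two entries $\alpha_i-1,\,1$ if $\alpha_i>1$, and replaces $\alpha_{i-1},\alpha_i$ by the single entry $\alpha_{i-1}+1$ if $\alpha_i=1$. For $d=2^k(2t+1)$ put $\lambda(d)=h_k((0))$ if $t=0$ and $\lambda(d)=h_k((0))\star(2,1^{2t-2})$ if $t>0$, where $1^{q}$ is $1$ repeated $q$ times. **Procedure.** Let $n\ge1$, $n=2^l(2s+1)$. 1. Write $h_0((0)),h_1((0)),\dots,h_l((0))$ and then $\alpha=\lambda(n)$. 2. If $\alpha$ is the sequence $(n-1)$, stop. Otherwise apply one elementary operation on the tail of the longest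 left sequence of $\alpha$ of even length for which the result $\alpha'$ is a lexical successor, i.e. $\alpha'\in L_n$ and $\alpha<\alpha'$. 3. Let $f=\alpha\wedge\alpha'$, let $m=1+D(f)$, and divide $n=dm+r$ with $0\le r<m$. If $r>0$, write $\alpha'$. If $r=0$, with $d=2^k(2t+1)$, write $h_0(f),h_1(f),\dots,h_k(f)$ and then $f\star\lambda(d)$, and set $\alpha'=f\star\lambda(d)$. 4. Repeat from step 2 with $\alpha'$ in place of $\alpha$. In steps 1 and 3, if the last harmonic equals the element that follows it (as happens when $s=0$, resp. $t=0$), it is written only once. **Theorem.** For every $n\ge1$: * $\lambda(n)$ is the least element of $L_n$. * The procedure can always be carried out (in step 2 a suitable left sequence exists, and in step 3 $f\in L_m$), its run is uniquely determined, and it terminates. * The list it writes is strictly increasing and consists of exactly the elements of $D_n$; each element of the list is adjacent in $D_n$ to the next one. * The list of the successive elements $\alpha$ at which the procedure stands (what remains of the list when the inserted harmonics are left out) is strictly increasing and consists of exactly the elements of $L_n$; each is adjacent in $L_n$ to the next one. -/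

import Mathlib

namespace LexSeq

/-- Finite sequences of natural numbers. The `α`-sequences are the lists with positive entries; the
empty list represents the special sequence `(0)`, of degree `0`. A trailing or leading `0` is
dropped in products, as in `h₁(0) = (0)ₒ(0) = (1)(0) = (1)`. -/
abbrev Sequence := List ℕ

/-- `Al(τ) = (τ₁, -τ₂, τ₃, -τ₄, …, 0, 0, …)`, with places counted from `0`. -/
def Al (τ : Sequence) (i : ℕ) : ℤ := (-1) ^ i * (τ.getD i 0 : ℤ)

/-- `τ < τ'`: the first nonzero term of `Al(τ) - Al(τ')` is negative. -/
def Lt (τ τ' : Sequence) : Prop :=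
  ∃ i, (∀ j < i, Al τ j = Al τ' j) ∧ Al τ i < Al τ' i

theorem lt_iff_bounded (τ τ' : Sequence) :
    Lt τ τ' ↔ ∃ i < max τ.length τ'.length, (∀ j < i, Al τ j = Al τ' j) ∧ Al τ i < Al τ' i := by
  constructor
  · rintro ⟨i, h1, h2⟩
    refine ⟨i, ?_, h1, h2⟩
    by_contra hi
    have hi' : τ.length ≤ i ∧ τ'.length ≤ i := by omega
    simp only [Al, List.getD_eq_default _ _ hi'.1, List.getD_eq_default _ _ hi'.2] at h2
    exact lt_irrefl _ h2
  · rintro ⟨i, -, h⟩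
    exact ⟨i, h⟩

instance (τ τ' : Sequence) : Decidable (Lt τ τ') :=
  decidable_of_iff _ (lt_iff_bounded τ τ').symm

/-- `α` is greater than each of its proper right sequences. -/
def Lexical (α : Sequence) : Prop := ∀ i < α.length, 1 ≤ i → Lt (α.drop i) α

instance (α : Sequence) : Decidable (Lexical α) :=
  inferInstanceAs (Decidable (∀ i < α.length, 1 ≤ i → Lt (α.drop i) α))

/-- The degree `D(α)`. -/
def degree (α : Sequence) : ℕ := α.sum

/-- Lexical sequences (of positive numbers) with `1 + D(α) = n`; `L 1 = {(0)}`. -/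
def L (n : ℕ) : Set Sequence := {α | (∀ x ∈ α, 0 < x) ∧ Lexical α ∧ 1 + degree α = n}

instance (n : ℕ) (α : Sequence) : Decidable (α ∈ L n) :=
  inferInstanceAs (Decidable ((∀ x ∈ α, 0 < x) ∧ Lexical α ∧ 1 + degree α = n))

/-- `D_n`, the union of the `L_d` over the divisors `d` of `n`. -/
def D (n : ℕ) : Set Sequence := ⋃ d ∈ {d : ℕ | d ∣ n}, L d

/-- `α` is adjacent to `β` in `S`: `α < β` with nothing of `S` strictly between. -/
def AdjLt (S : Set Sequence) (α β : Sequence) : Prop :=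
  α ∈ S ∧ β ∈ S ∧ Lt α β ∧ ¬ ∃ γ ∈ S, Lt α γ ∧ Lt γ β

/-- Add `1` to the last entry. -/
def incrLast (α : Sequence) : Sequence := α.dropLast ++ [α.getLastD 0 + 1]

/-- `α_e`, of even length (only used for `α ≠ (0)`). -/
def seqE (α : Sequence) : Sequence := if Even α.length then incrLast α else α ++ [1]

/-- `α_o`, of odd length; `(0)_o = (1)`. -/
def seqO (α : Sequence) : Sequence := if Even α.length then α ++ [1] else incrLast α

/-- The harmonics `h_0(α) = α`, `h_j(α) = (h_{j-1}(α))_o h_{j-1}(α)`. -/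
def harmonic (α : Sequence) : ℕ → Sequence
  | 0 => α
  | j + 1 => seqO (harmonic α j) ++ harmonic α j

/-- The star product
`α ⋆ (β₁, …, β_k) = α_o (α_e)^(β₁-1) α_o (α_e)^(β₂-1) ⋯ α_o (α_e)^(β_k-1) α`, and `(0) ⋆ β = β`
(read `(0)_o = (1)`, `(0)_e = (0,1)`, a zero entry being deleted and its two neighbours added up,
so that `(0)_o (0)_e^(b-1)` is `(b)`). -/
def star (α β : Sequence) : Sequence :=
  if α = [] then β
  else β.flatMap (fun b => seqO α ++ (List.replicate (b - 1) (seqE α)).flatten) ++ α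

/-- Longest common left factor: the common beginning followed by the smaller of the first two
entries that differ. -/
def wedge : Sequence → Sequence → Sequence
  | a :: α, b :: β => if a = b then a :: wedge α β else [min a b]
  | _, _ => []

/-- The elementary operation on the `i`-th cell (`i` counted from `1`): split it if its value is
greater than `1`, conjugate it with its left neighbour if its value is `1`. -/
def elemOp (α : Sequence) (i : ℕ) : Sequence :=
  let v := α.getD (i - 1) 0
  let left := if 1 < v then α.take (i - 1) ++ [v - 1] else α.take (i - 1)
  (if Even i then seqO left else seqE left) ++ α.drop i

/-- The lengths of the nonempty left sequences of even length, longest first. -/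
def evenCells (α : Sequence) : List ℕ :=
  (List.range (α.length + 1)).reverse.filter (fun i => 0 < i ∧ Even i)

/-- Apply one elementary operation on the tail of the longest left sequence of even length which
gives a lexical successor in `L n` (`none` if there is no such left sequence). -/
def nextOp (n : ℕ) (α : Sequence) : Option Sequence :=
  ((evenCells α).map (elemOp α)).find? (fun α' => α' ∈ L n ∧ Lt α α')

/-- The exponent `l` in `n = 2^l (2 s + 1)`. -/
def expTwo (n : ℕ) : ℕ := padicValNat 2 n

/-- The number `s` in `n = 2^l (2 s + 1)`. -/
def oddHalf (n : ℕ) : ℕ := (n / 2 ^ expTwo n - 1) / 2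

/-- The sequence computed as the least element of `L n`, for `n = 2^l (2 s + 1)`:
`h_l(0)` if `s = 0`, and `h_l(0) ⋆ (2, 1^(2s-2))` if `s > 0`. -/
def leastSeq (n : ℕ) : Sequence :=
  if oddHalf n = 0 then harmonic [] (expTwo n)
  else star (harmonic [] (expTwo n)) (2 :: List.replicate (2 * oddHalf n - 2) 1)

/-- The sequence `(n-1)`. -/
def maxSeq (n : ℕ) : Sequence := if n = 1 then [] else [n - 1]

/-- One stage of the listing: a string of inserted sequences and then an element of `L n`. -/
abbrev Stage := List Sequence × Sequence

/-- The string `h_0(f), h_1(f), …, h_k(f), f ⋆ λ`, where `d = 2^k (2 t + 1)` and `λ` is the least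
element of `L d`. If the harmonic `h_k(f)` is `f ⋆ λ` itself, it is not written twice. -/
def harmonicStage (f : Sequence) (d : ℕ) : Stage :=
  (((List.range (expTwo d + 1)).map (harmonic f)).filter (fun g => g ≠ star f (leastSeq d)),
    star f (leastSeq d))

/-- The stage that follows, once the elementary operation has given `α'` and `f = α ∧ α'` has been
extracted: with `f ∈ L m` and `n = d m + r`, it is `α'` alone if `r > 0`, and the harmonics of `f`
followed by `f ⋆ λ` if `r = 0`. -/
def nextStage (n : ℕ) (f α' : Sequence) : Stage :=
  if 0 < n % (1 + degree f) then ([], α') else harmonicStage f (n / (1 + degree f))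

/-- `RunFrom n α ss`: the procedure, standing at `α`, writes the stages `ss` and then ends, having
reached `(n-1)`. -/
inductive RunFrom (n : ℕ) : Sequence → List Stage → Prop
  | done : RunFrom n (maxSeq n) []
  | step (α α' f : Sequence) (ss : List Stage) (hα : α ≠ maxSeq n)
      (hop : nextOp n α = some α') (hf : f = wedge α α') (hfL : f ∈ L (1 + degree f))
      (hrest : RunFrom n (nextStage n f α').2 ss) :
      RunFrom n α (nextStage n f α' :: ss)

/-- A complete run: it starts with the harmonics of `(0)` and the sequence `μ = leastSeq n`. -/
def IsRun (n : ℕ) (run : List Stage) : Prop :=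
  ∃ start ss, start = ((((List.range (expTwo n + 1)).map (harmonic [])).filter
      (fun g => g ≠ leastSeq n), leastSeq n) : Stage) ∧
    RunFrom n start.2 ss ∧ run = start :: ss

/-- The complete list written by a run. -/
def output (run : List Stage) : List Sequence := run.flatMap (fun s => s.1 ++ [s.2])

/-- The elements at which the run stands successively, without the inserted harmonics. -/
def mainElements (run : List Stage) : List Sequence := run.map Prod.snd

end LexSeq

namespace LexSeq

/-! The sequences are read as points of the tent map T. Code (α₁, …, α_k) by the itinerary R
L^(α₁-1) R L^(α₂-1) … C, where L and R are the two halves of the interval and C is 1/2; the point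
with this itinerary is `val α`, a dyadic rational in [1/2, 1) of order n = 1 + D(α), that is, an odd
multiple of 2⁻ⁿ. The alternating order becomes the usual order of ℚ (`lt_iff_val`), and lexical
means that the point exceeds its first n - 1 images (`mem_L_iff`, `Mx`). If p = `val f` has order m,
then f_e g and f_o g are the two points, left and right of p, that T^m carries to `val g`
(`val_seqE`, `val_seqO`). So an elementary operation is a reflection in a dyadic point, and the star
product is the renormalization `Img` attached to p (`star_img`), an order-preserving map that
multiplies orders by m and, for shift-maximal p, preserves and reflects shift-maximality
(`Img.mx_iff`).

Let a < b be consecutive shift-maximal points of order n, and p the point of least order m between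
them (`Gap`). On [a, b] the iterates T^j, j < m, are affine, so p is itself shift-maximal. Two facts
carry the proof. By `Gap.lt_order_add`, a shift-maximal point strictly between a and p has order
greater than n - m. By `Gap.mirror_mx`, the reflection 2p - a is always shift-maximal. Both are
inductions on n: if p is renormalized from some q < a of order at least 2, the whole gap is the
image of a smaller one; otherwise p is compared with a neighbouring gap.

If m does not divide n, it follows that b = 2p - a and that no element of D_n lies strictly between
a and b. If n = dm, all elements of D_n in the gap are renormalized from p: b is the image of the
least shift-maximal point of order d (`Gap.right_img`), and those strictly inside are harmonics of p
(`Gap.exists_harm_img`). The procedure does find p: the reflection in p is an admissible elementary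
operation by `Gap.mirror_mx`, while the operation on a longer left sequence reflects in a point of
order greater than m and moves too little to get past p.

The least points come from the interval [2/3, 5/6], which T² folds into itself around 3/4.
Shift-maximal points of order at least 2 in it are renormalized from 3/4 and have even order. Hence
the least point of odd order q + 3 is the first one above 5/6, `zig q`, and the least point of order
2n is the renormalization of that of order n (`IsLeastMx.double`). -/

/-! ### The tent map and dyadic rationals -/

/-- The tent map. -/
def tent (x : ℚ) : ℚ := if x < 1 / 2 then 2 * x else 2 - 2 * x

/-- `Dy k y`: `y` is an odd multiple of `2⁻ᵏ` in `(0, 1)`. -/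
inductive Dy : ℕ → ℚ → Prop
  | base : Dy 1 (1 / 2)
  | left {k : ℕ} {y : ℚ} : Dy k y → Dy (k + 1) (y / 2)
  | right {k : ℕ} {y : ℚ} : Dy k y → Dy (k + 1) (1 - y / 2)

theorem tent_left {x : ℚ} (h : x ≤ 1 / 2) : tent x = 2 * x := by
  unfold tent; split_ifs with h' <;> linarith

theorem tent_right {x : ℚ} (h : 1 / 2 ≤ x) : tent x = 2 - 2 * x := by
  unfold tent; split_ifs with h' <;> linarith

theorem inv_pow_succ (k : ℕ) : (1 : ℚ) / 2 ^ (k + 1) = 1 / 2 ^ k / 2 := by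
  rw [pow_succ]; field_simp

theorem inv_pow_pos (k : ℕ) : (0 : ℚ) < 1 / 2 ^ k := by positivity

theorem inv_pow_le {a b : ℕ} (h : a ≤ b) : (1 : ℚ) / 2 ^ b ≤ 1 / 2 ^ a :=
  one_div_le_one_div_of_le (by positivity) (pow_le_pow_right₀ (by norm_num) h)

theorem Dy.pos_order {k : ℕ} {y : ℚ} (h : Dy k y) : 1 ≤ k := by cases h <;> omega

theorem Dy.bounds {k : ℕ} {y : ℚ} (h : Dy k y) : 1 / 2 ^ k ≤ y ∧ y ≤ 1 - 1 / 2 ^ k := by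
  induction h with
  | base => norm_num
  | left h ih => rw [inv_pow_succ]; constructor <;> linarith [ih.1, ih.2, inv_pow_pos ‹_›]
  | right h ih => rw [inv_pow_succ]; constructor <;> linarith [ih.1, ih.2, inv_pow_pos ‹_›]

theorem Dy.pos {k : ℕ} {y : ℚ} (h : Dy k y) : 0 < y := lt_of_lt_of_le (inv_pow_pos k) h.bounds.1

theorem Dy.lt_one {k : ℕ} {y : ℚ} (h : Dy k y) : y < 1 := by
  linarith [h.bounds.2, inv_pow_pos k]

theorem Dy.one_eq {y : ℚ} (h : Dy 1 y) : y = 1 / 2 := by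
  generalize hk : 1 = k at h
  cases h with
  | base => rfl
  | left h => have := h.pos_order; omega
  | right h => have := h.pos_order; omega

theorem tent_half {y : ℚ} (h : y ≤ 1) : tent (y / 2) = y := by
  rw [tent_left (by linarith)]; ring

theorem tent_one_sub {y : ℚ} (h : y ≤ 1) : tent (1 - y / 2) = y := by
  rw [tent_right (by linarith)]; ring

theorem Dy.int {k : ℕ} {y : ℚ} (h : Dy k y) : ∃ j : ℤ, y * 2 ^ k = 2 * j + 1 := by
  induction h with
  | base => exact ⟨0, by norm_num⟩
  | @left k y h ih =>
    obtain ⟨j, hj⟩ := ih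
    exact ⟨j, by rw [pow_succ]; linarith⟩
  | @right k y h ih =>
    obtain ⟨j, hj⟩ := ih
    refine ⟨2 ^ k - j - 1, ?_⟩
    push_cast
    rw [pow_succ]; linarith

theorem Dy.int_of_le {a k : ℕ} {y : ℚ} (h : Dy k y) (hk : k ≤ a) : ∃ j : ℤ, y * 2 ^ a = j := by
  obtain ⟨j, hj⟩ := h.int
  obtain ⟨c, rfl⟩ := Nat.exists_eq_add_of_le hk
  refine ⟨(2 * j + 1) * 2 ^ c, ?_⟩
  push_cast
  rw [pow_add, ← mul_assoc, hj]

/-- Dyadic points are separated. -/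
theorem Dy.sep {a b : ℕ} {x y : ℚ} (hx : Dy a x) (hy : Dy b y) (hba : b ≤ a) (hne : y ≠ x) :
    1 / 2 ^ a ≤ |y - x| := by
  obtain ⟨i, hi⟩ := hx.int_of_le le_rfl
  obtain ⟨j, hj⟩ := hy.int_of_le hba
  have hp : (0 : ℚ) < 2 ^ a := by positivity
  have hij : j - i ≠ 0 := by
    intro h
    have : j = i := by omega
    subst this
    exact hne (mul_right_cancel₀ hp.ne' (hj.trans hi.symm))
  have h1 : (1 : ℚ) ≤ |((j - i : ℤ) : ℚ)| := by exact_mod_cast Int.one_le_abs hij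
  have h2 : ((j - i : ℤ) : ℚ) = (y - x) * 2 ^ a := by push_cast; rw [← hi, ← hj]; ring
  rw [h2, abs_mul, abs_of_pos hp] at h1
  rw [div_le_iff₀ hp]; exact h1

theorem Dy.order_unique {a b : ℕ} {x : ℚ} (hx : Dy a x) (hy : Dy b x) : a = b := by
  wlog h : a < b generalizing a b
  · rcases lt_trichotomy a b with h1 | h1 | h1
    · exact this hx hy h1
    · exact h1
    · exact (this hy hx h1).symm
  obtain ⟨i, hi⟩ := hy.int
  obtain ⟨j, hj⟩ := hx.int_of_le (show a ≤ b - 1 by omega)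
  have hb : b = (b - 1) + 1 := by omega
  rw [hb, pow_succ, ← mul_assoc, hj] at hi
  have : j * 2 = 2 * i + 1 := by exact_mod_cast hi
  omega

theorem Dy.ne_of_order {a b : ℕ} {x y : ℚ} (hx : Dy a x) (hy : Dy b y) (h : a ≠ b) : x ≠ y := by
  rintro rfl; exact h (hx.order_unique hy)

theorem iterate_succ_tent (j : ℕ) (x : ℚ) : tent^[j + 1] x = tent^[j] (tent x) := rfl

theorem iterate_add_tent (i j : ℕ) (x : ℚ) : tent^[i + j] x = tent^[i] (tent^[j] x) :=
  Function.iterate_add_apply _ _ _ _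

theorem Dy.tent_mem {k : ℕ} {y : ℚ} (h : Dy (k + 2) y) : Dy (k + 1) (tent y) := by
  generalize hn : k + 2 = n at h
  cases h with
  | base => omega
  | @left k' y' h => rw [tent_half h.lt_one.le]; rwa [show k + 1 = k' by omega]
  | @right k' y' h => rw [tent_one_sub h.lt_one.le]; rwa [show k + 1 = k' by omega]

theorem Dy.iterate {k : ℕ} {y : ℚ} (h : Dy k y) {j : ℕ} (hj : j < k) : Dy (k - j) (tent^[j] y) := by
  induction j generalizing k y with
  | zero => exact h
  | succ j ih =>
    obtain ⟨k, rfl⟩ : ∃ k', k = k' + 2 := ⟨k - 2, by omega⟩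
    have := ih h.tent_mem (by omega)
    rwa [show k + 2 - (j + 1) = k + 1 - j by omega]

/-- Near a dyadic point of order `m`, the first iterates of the tent map are affine. -/
theorem Dy.affine {m : ℕ} {p : ℚ} (h : Dy m p) {j : ℕ} (hj : j < m) :
    ∃ s : ℚ, (s = 1 ∨ s = -1) ∧ ∀ y, |y - p| ≤ 1 / 2 ^ m →
      tent^[j] y = tent^[j] p + s * 2 ^ j * (y - p) := by
  induction h generalizing j with
  | base =>
    obtain rfl : j = 0 := by omega
    exact ⟨1, Or.inl rfl, fun y _ => by simp⟩
  | @left k q h ih =>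
    rcases j with _ | j
    · exact ⟨1, Or.inl rfl, fun y _ => by simp⟩
    obtain ⟨s, hs, H⟩ := ih (j := j) (by omega)
    refine ⟨s, hs, fun y hy => ?_⟩
    rw [inv_pow_succ] at hy
    have hb := h.bounds
    have := abs_le.1 hy
    rw [iterate_succ_tent, iterate_succ_tent, tent_half h.lt_one.le, tent_left (by linarith),
      H (2 * y) (by rw [abs_le]; constructor <;> linarith), pow_succ]
    ring
  | @right k q h ih =>
    rcases j with _ | j
    · exact ⟨1, Or.inl rfl, fun y _ => by simp⟩
    obtain ⟨s, hs, H⟩ := ih (j := j) (by omega)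
    refine ⟨-s, by rcases hs with rfl | rfl <;> simp, fun y hy => ?_⟩
    rw [inv_pow_succ] at hy
    have hb := h.bounds
    have := abs_le.1 hy
    rw [iterate_succ_tent, iterate_succ_tent, tent_one_sub h.lt_one.le, tent_right (by linarith),
      H (2 - 2 * y) (by rw [abs_le]; constructor <;> linarith), pow_succ]
    ring

theorem Dy.abs_iterate_sub {m : ℕ} {p : ℚ} (h : Dy m p) {j : ℕ} (hj : j < m) {y : ℚ}
    (hy : |y - p| ≤ 1 / 2 ^ m) : |tent^[j] y - tent^[j] p| = 2 ^ j * |y - p| := by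
  obtain ⟨s, hs, H⟩ := h.affine hj
  rw [H y hy, add_sub_cancel_left, abs_mul, abs_mul, abs_of_pos (by positivity : (0 : ℚ) < 2 ^ j)]
  rcases hs with rfl | rfl <;> simp

/-- The `m`-th iterate is a tent centred at a dyadic point of order `m`. -/
theorem Dy.peak {m : ℕ} {p : ℚ} (h : Dy m p) {y : ℚ} (hy : |y - p| ≤ 1 / 2 ^ m) :
    tent^[m] y = 1 - 2 ^ m * |y - p| := by
  induction h generalizing y with
  | base =>
    have := abs_le.1 hy
    change tent y = _
    rcases le_total y (1 / 2) with h | h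
    · rw [tent_left h, abs_of_nonpos (by linarith)]; ring
    · rw [tent_right h, abs_of_nonneg (by linarith)]; ring
  | @left k q h ih =>
    rw [inv_pow_succ] at hy
    have hb := h.bounds
    have := abs_le.1 hy
    have e : 2 * y - q = 2 * (y - q / 2) := by ring
    have e' : |2 * y - q| = 2 * |y - q / 2| := by rw [e, abs_mul]; norm_num
    rw [iterate_succ_tent, tent_left (by linarith), ih (by rw [e']; linarith), e', pow_succ]
    ring
  | @right k q h ih =>
    rw [inv_pow_succ] at hy
    have hb := h.bounds
    have := abs_le.1 hy
    have e : 2 - 2 * y - q = -2 * (y - (1 - q / 2)) := by ring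
    have e' : |2 - 2 * y - q| = 2 * |y - (1 - q / 2)| := by rw [e, abs_mul]; norm_num
    rw [iterate_succ_tent, tent_right (by linarith), ih (by rw [e']; linarith), e', pow_succ]
    ring

/-- The point q has the itinerary of z up to place j - 1 and C at place j. -/
theorem Dy.trunc {c j : ℕ} {z : ℚ} (h : Dy c z) (hj : 1 ≤ j) (hjc : j < c) :
    ∃ q, Dy j q ∧ |z - q| < 1 / 2 ^ j := by
  induction h generalizing j with
  | base => omega
  | @left k y h ih =>
    rcases Nat.lt_or_ge 1 j with h1 | h1
    · obtain ⟨j, rfl⟩ : ∃ i, j = i + 1 := ⟨j - 1, by omega⟩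
      obtain ⟨q, hq, hd⟩ := ih (j := j) (by omega) (by omega)
      refine ⟨q / 2, hq.left, ?_⟩
      rw [inv_pow_succ]
      rw [abs_lt] at hd ⊢
      constructor <;> linarith
    · obtain rfl : j = 1 := by omega
      refine ⟨1 / 2, .base, ?_⟩
      have := h.pos; have := h.lt_one
      rw [abs_lt]; constructor <;> norm_num <;> linarith
  | @right k y h ih =>
    rcases Nat.lt_or_ge 1 j with h1 | h1
    · obtain ⟨j, rfl⟩ : ∃ i, j = i + 1 := ⟨j - 1, by omega⟩
      obtain ⟨q, hq, hd⟩ := ih (j := j) (by omega) (by omega)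
      refine ⟨1 - q / 2, hq.right, ?_⟩
      rw [inv_pow_succ]
      rw [abs_lt] at hd ⊢
      constructor <;> linarith
    · obtain rfl : j = 1 := by omega
      refine ⟨1 / 2, .base, ?_⟩
      have := h.pos; have := h.lt_one
      rw [abs_lt]; constructor <;> norm_num <;> linarith

/-- Grafting a dyadic point onto either side of another one. -/
theorem Dy.graft {m c : ℕ} {p u : ℚ} (hp : Dy m p) (hu : Dy c u) :
    Dy (c + m) (p - (1 - u) / 2 ^ m) ∧ Dy (c + m) (p + (1 - u) / 2 ^ m) := by
  induction hp with
  | base =>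
    constructor
    · convert hu.left using 1; ring
    · convert hu.right using 1; ring
  | @left k q h ih =>
    rw [← add_assoc]
    constructor
    · convert ih.1.left using 1; rw [pow_succ (2 : ℚ)]; field_simp
    · convert ih.2.left using 1; rw [pow_succ (2 : ℚ)]; field_simp
  | @right k q h ih =>
    rw [← add_assoc]
    constructor
    · convert ih.2.right using 1; rw [pow_succ (2 : ℚ)]; field_simp; ring
    · convert ih.1.right using 1; rw [pow_succ (2 : ℚ)]; field_simp; ring

/-- Two itineraries of equal length ending in C first differ at a place where one has L and the
other R; putting C there gives p. The sign of a product is used because the right branch reverses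
the order at each pull-back. -/
theorem Dy.exists_between {n : ℕ} {a b : ℚ} (ha : Dy n a) (hb : Dy n b) (hab : a ≠ b) :
    ∃ m p, m < n ∧ Dy m p ∧ (a - p) * (b - p) < 0 ∧ |a - p| < 1 / 2 ^ m ∧ |b - p| < 1 / 2 ^ m := by
  induction ha generalizing b with
  | base => exact absurd hb.one_eq.symm hab
  | @left k x h ih =>
    have hx := h.pos; have hx1 := h.lt_one
    have hk := h.pos_order
    generalize hn : k + 1 = n at hb
    cases hb with
    | base => omega
    | @left k' y h' =>
      obtain rfl : k = k' := by omega
      obtain ⟨m, p, hm, hp, h1, h3, h4⟩ := ih h' (fun h => hab (by rw [h]))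
      refine ⟨m + 1, p / 2, by omega, hp.left, by linarith, ?_, ?_⟩ <;>
      · rw [inv_pow_succ]
        rw [abs_lt] at h3 h4 ⊢
        constructor <;> linarith
    | @right k' y h' =>
      have := h'.pos; have := h'.lt_one
      refine ⟨1, 1 / 2, by omega, .base, mul_neg_of_neg_of_pos (by linarith) (by linarith), ?_, ?_⟩ <;>
      · rw [abs_lt]; constructor <;> norm_num <;> linarith
  | @right k x h ih =>
    have hx := h.pos; have hx1 := h.lt_one
    have hk := h.pos_order
    generalize hn : k + 1 = n at hb
    cases hb with
    | base => omega
    | @left k' y h' =>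
      have := h'.pos; have := h'.lt_one
      refine ⟨1, 1 / 2, by omega, .base, mul_neg_of_pos_of_neg (by linarith) (by linarith), ?_, ?_⟩ <;>
      · rw [abs_lt]; constructor <;> norm_num <;> linarith
    | @right k' y h' =>
      obtain rfl : k = k' := by omega
      obtain ⟨m, p, hm, hp, h1, h3, h4⟩ := ih h' (fun h => hab (by rw [h]))
      refine ⟨m + 1, 1 - p / 2, by omega, hp.right, by linarith, ?_, ?_⟩ <;>
      · rw [inv_pow_succ]
        rw [abs_lt] at h3 h4 ⊢
        constructor <;> linarith

/-- Two distinct points of the same order are separated by a point of lower order which is close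
to both of them. -/
theorem Dy.between {n : ℕ} {a b : ℚ} (ha : Dy n a) (hb : Dy n b) (hab : a < b) :
    ∃ m p, m < n ∧ Dy m p ∧ a < p ∧ p < b ∧ |a - p| < 1 / 2 ^ m ∧ |b - p| < 1 / 2 ^ m := by
  obtain ⟨m, p, hm, hp, h1, h3, h4⟩ := ha.exists_between hb hab.ne
  rcases mul_neg_iff.1 h1 with h | h
  · linarith [h.1, h.2]
  · exact ⟨m, p, hm, hp, by linarith [h.1], by linarith [h.2], h3, h4⟩

theorem Dy.finite (n : ℕ) : {x | Dy n x}.Finite := by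
  induction n with
  | zero => exact Set.Finite.subset Set.finite_empty fun x h => absurd (Dy.pos_order h) (by omega)
  | succ n ih =>
    refine Set.Finite.subset (((Set.finite_singleton (1 / 2 : ℚ)).union (ih.image (fun y => y / 2))).union
      (ih.image (fun y => 1 - y / 2))) ?_
    intro x h
    cases h with
    | base => exact Or.inl (Or.inl rfl)
    | left h => exact Or.inl (Or.inr ⟨_, h, rfl⟩)
    | right h => exact Or.inr ⟨_, h, rfl⟩

theorem Dy.abs_sub_eq {m : ℕ} {p y : ℚ} (hp : Dy m p) (hy : |y - p| ≤ 1 / 2 ^ m) :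
    |y - p| = (1 - tent^[m] y) / 2 ^ m := by
  rw [hp.peak hy]; field_simp; ring

/-- The two grafts onto p are the points near p, on either side, that the m-th iterate maps to u. -/
theorem Dy.iterate_graft {m : ℕ} {p u : ℚ} (hp : Dy m p) (h0 : 0 ≤ u) (h1 : u ≤ 1) :
    tent^[m] (p - (1 - u) / 2 ^ m) = u ∧ tent^[m] (p + (1 - u) / 2 ^ m) = u := by
  have hpos : (0 : ℚ) < 2 ^ m := by positivity
  have e1 : |p - (1 - u) / 2 ^ m - p| = (1 - u) / 2 ^ m := by
    rw [show p - (1 - u) / 2 ^ m - p = -((1 - u) / 2 ^ m) by ring, abs_neg,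
      abs_of_nonneg (div_nonneg (by linarith) hpos.le)]
  have e2 : |p + (1 - u) / 2 ^ m - p| = (1 - u) / 2 ^ m := by
    rw [add_sub_cancel_left, abs_of_nonneg (div_nonneg (by linarith) hpos.le)]
  have e3 : (1 - u) / 2 ^ m ≤ 1 / 2 ^ m := by gcongr; linarith
  constructor
  · rw [hp.peak (by rw [e1]; exact e3), e1]; field_simp; ring
  · rw [hp.peak (by rw [e2]; exact e3), e2]; field_simp; ring

/-- The mirror image in a dyadic point of lower order. -/
theorem Dy.mirror {m c : ℕ} {p z : ℚ} (hp : Dy m p) (hz : Dy c z) (hmc : m < c)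
    (h : |z - p| ≤ 1 / 2 ^ m) : Dy c (2 * p - z) ∧ ∀ i, m ≤ i → tent^[i] (2 * p - z) = tent^[i] z := by
  have h1 := hp.abs_sub_eq h
  have hd := hz.iterate hmc
  have hg := hp.graft hd
  rw [Nat.sub_add_cancel hmc.le] at hg
  have hi := hp.iterate_graft hd.pos.le hd.lt_one.le
  have hm : Dy c (2 * p - z) ∧ tent^[m] (2 * p - z) = tent^[m] z := by
    rcases abs_choice (z - p) with h2 | h2
    · rw [show 2 * p - z = p - (1 - tent^[m] z) / 2 ^ m by linarith]
      exact ⟨hg.1, hi.1⟩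
    · rw [show 2 * p - z = p + (1 - tent^[m] z) / 2 ^ m by linarith]
      exact ⟨hg.2, hi.2⟩
  refine ⟨hm.1, fun i hi => ?_⟩
  obtain ⟨k, rfl⟩ := Nat.exists_eq_add_of_le' hi
  rw [iterate_add_tent, iterate_add_tent, hm.2]

/-! ### Shift-maximal dyadic points -/

/-- A dyadic point of order `n` which exceeds its first `n - 1` images under the tent map. -/
def Mx (n : ℕ) (x : ℚ) : Prop := Dy n x ∧ ∀ i, 1 ≤ i → i < n → tent^[i] x < x

theorem Mx.iterate_le {n : ℕ} {x : ℚ} (h : Mx n x) {i : ℕ} (hi : i < n) : tent^[i] x ≤ x := by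
  rcases Nat.eq_zero_or_pos i with rfl | h0
  · exact le_rfl
  · exact (h.2 i h0 hi).le

/-- Start the itinerary at the largest iterate. There are no ties, since different iterates have
different orders. -/
theorem Dy.exists_max {c : ℕ} {z : ℚ} (hz : Dy c z) :
    ∃ j < c, Mx (c - j) (tent^[j] z) ∧ ∀ i < c, tent^[i] z ≤ tent^[j] z := by
  obtain ⟨j, hj, H⟩ := Finset.exists_max_image (Finset.range c) (fun i => tent^[i] z)
    ⟨0, Finset.mem_range.2 hz.pos_order⟩
  rw [Finset.mem_range] at hj
  refine ⟨j, hj, ⟨hz.iterate hj, fun i h1 h2 => ?_⟩, fun i hi => H i (Finset.mem_range.2 hi)⟩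
  rw [← iterate_add_tent]
  refine lt_of_le_of_ne (H (i + j) (Finset.mem_range.2 (by omega))) ?_
  exact (hz.iterate (show i + j < c by omega)).ne_of_order (hz.iterate hj) (by omega)

/-- The first return above a point determines a shift-maximal point near it. -/
theorem Dy.first_return {j : ℕ} {z q : ℚ} (hq : Dy j q)
    (hmin : ∀ i, 1 ≤ i → i < j → tent^[i] z < z) (hr : z ≤ tent^[j] z)
    (hzq : |z - q| < 1 / 2 ^ j) : Mx j q := by
  refine ⟨hq, fun k hk hkj => ?_⟩
  have hzk := hmin k hk hkj
  have hd := hq.iterate hkj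
  have hk' := hq.abs_iterate_sub hkj hzq.le
  have hne : q ≠ tent^[k] q := hq.ne_of_order hd (by omega)
  by_contra hcon
  have hlt : q < tent^[k] q := lt_of_le_of_ne (not_lt.1 hcon) hne
  have hpow : (2 : ℚ) ^ k * (1 / 2 ^ j) = 1 / 2 ^ (j - k) := by
    obtain ⟨d, rfl⟩ := Nat.exists_eq_add_of_le hkj.le
    rw [Nat.add_sub_cancel_left, pow_add]; field_simp
  have hclose : |tent^[k] z - tent^[k] q| < 1 / 2 ^ (j - k) := by
    rw [hk', ← hpow]
    exact mul_lt_mul_of_pos_left hzq (by positivity)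
  -- If z ≤ T^k q, then z and T^k z lie on the rising side of the tent over T^k q, so T^k z < z
  -- gives T^j z < T^(j-k) z < z, against the return. Otherwise T^k q, a point of smaller order,
  -- lies between q and z and is too close to q.
  rcases le_or_gt z (tent^[k] q) with h | h
  · have h1 : |tent^[k] z - tent^[k] q| = tent^[k] q - tent^[k] z := by
      rw [abs_of_nonpos (by linarith)]; ring
    have h2 : |z - tent^[k] q| = tent^[k] q - z := by rw [abs_of_nonpos (by linarith)]; ring
    have h3 := hd.peak hclose.le
    have h4 := hd.peak (y := z) (by rw [h2]; rw [h1] at hclose; linarith)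
    rw [← iterate_add_tent, Nat.sub_add_cancel hkj.le, h1] at h3
    rw [h2] at h4
    have h5 := hmin (j - k) (by omega) (by omega)
    have h6 : (2 : ℚ) ^ (j - k) * (tent^[k] q - z) < 2 ^ (j - k) * (tent^[k] q - tent^[k] z) :=
      mul_lt_mul_of_pos_left (by linarith) (by positivity)
    linarith
  · have h1 := hq.sep hd (by omega) hne.symm
    rw [abs_of_pos (by linarith)] at h1
    rw [abs_of_pos (by linarith)] at hzq
    linarith

/-! ### Gaps -/

/-- `a` and `b` are consecutive shift-maximal points of order `n`, and `p` is the point of least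
order `m` between them. -/
structure Gap (n : ℕ) (a b : ℚ) (m : ℕ) (p : ℚ) : Prop where
  left : Mx n a
  right : Mx n b
  free : ∀ x, Mx n x → a < x → x < b → False
  mid : Dy m p
  lt_mid : a < p
  mid_lt : p < b
  near_left : p - a < 1 / 2 ^ m
  near_right : b - p < 1 / 2 ^ m
  order_lt : m < n

theorem exists_gap {n : ℕ} {a b : ℚ} (ha : Mx n a) (hb : Mx n b) (hab : a < b)
    (free : ∀ x, Mx n x → a < x → x < b → False) : ∃ m p, Gap n a b m p := by
  obtain ⟨m, p, hm, hp, h1, h2, h3, h4⟩ := ha.1.between hb.1 hab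
  refine ⟨m, p, ha, hb, free, hp, h1, h2, ?_, ?_, hm⟩
  · rw [abs_of_neg (by linarith)] at h3; linarith
  · rw [abs_of_pos (by linarith)] at h4; linarith

namespace Gap

variable {n m : ℕ} {a b p : ℚ}

/-- The whole gap lies within 2⁻ᵐ of p, where separation leaves no other point of order at most m.
-/
theorem order_le (G : Gap n a b m p) {c : ℕ} {y : ℚ} (hy : Dy c y) (h1 : a < y) (h2 : y < b) :
    m ≤ c ∧ (c = m → y = p) := by
  have key : c ≤ m → y = p := by
    intro hc
    by_contra hne
    have h3 := G.mid.sep hy hc hne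
    have h4 := G.near_left; have h5 := G.near_right
    have : |y - p| < 1 / 2 ^ m := by rw [abs_lt]; constructor <;> linarith
    linarith
  refine ⟨?_, fun h => key h.le⟩
  by_contra hc
  have := key (by omega)
  subst this
  exact hc (le_of_eq (G.mid.order_unique hy))

theorem abs_lt (G : Gap n a b m p) {y : ℚ} (h1 : a ≤ y) (h2 : y ≤ b) : |y - p| < 1 / 2 ^ m := by
  have h4 := G.near_left; have h5 := G.near_right
  rw [_root_.abs_lt]; constructor <;> linarith

/-- Between `a` and `b` the first `m - 1` images stay below the point. -/
theorem iterate_lt (G : Gap n a b m p) {y : ℚ} (h1 : a ≤ y) (h2 : y ≤ b) {j : ℕ} (hj : 1 ≤ j)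
    (hjm : j < m) : tent^[j] y < y := by
  obtain ⟨s, -, H⟩ := G.mid.affine hjm
  have ha := G.left.2 j hj (hjm.trans G.order_lt)
  have hb := G.right.2 j hj (hjm.trans G.order_lt)
  have hab : a < b := G.lt_mid.trans G.mid_lt
  rw [H _ (G.abs_lt le_rfl hab.le).le] at ha
  rw [H _ (G.abs_lt hab.le le_rfl).le] at hb
  rw [H _ (G.abs_lt h1 h2).le]
  -- The function T^j y - y is affine on [a, b] and negative at both ends; this writes it as the
  -- interpolation of its end values.
  have e : (b - a) * (tent^[j] p + s * 2 ^ j * (y - p) - y) =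
      (b - y) * (tent^[j] p + s * 2 ^ j * (a - p) - a) +
        (y - a) * (tent^[j] p + s * 2 ^ j * (b - p) - b) := by ring
  by_contra hcon
  have e1 : 0 ≤ (b - a) * (tent^[j] p + s * 2 ^ j * (y - p) - y) :=
    mul_nonneg (by linarith) (by linarith)
  have e2 : (b - y) * (tent^[j] p + s * 2 ^ j * (a - p) - a) ≤ 0 :=
    mul_nonpos_of_nonneg_of_nonpos (by linarith) (by linarith)
  have e3 : (y - a) * (tent^[j] p + s * 2 ^ j * (b - p) - b) ≤ 0 :=
    mul_nonpos_of_nonneg_of_nonpos (by linarith) (by linarith)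
  rcases eq_or_lt_of_le h1 with rfl | h1'
  · linarith
  · have : (y - a) * (tent^[j] p + s * 2 ^ j * (b - p) - b) < 0 :=
      mul_neg_of_pos_of_neg (by linarith) (by linarith)
    linarith

theorem mx_mid (G : Gap n a b m p) : Mx m p :=
  ⟨G.mid, fun _ h1 h2 => G.iterate_lt G.lt_mid.le G.mid_lt.le h1 h2⟩

theorem left_eq (G : Gap n a b m p) : a = p - (1 - tent^[m] a) / 2 ^ m := by
  have h := G.mid.abs_sub_eq (G.abs_lt le_rfl (G.lt_mid.trans G.mid_lt).le).le
  rw [abs_of_neg (by linarith [G.lt_mid])] at h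
  linarith

theorem mx_of_iterate_lt (G : Gap n a b m p) {c : ℕ} {y : ℚ} (hy : Dy c y) (h1 : a ≤ y)
    (h2 : y ≤ b) (h : ∀ i, m ≤ i → i < c → tent^[i] y < y) : Mx c y :=
  ⟨hy, fun i hi hic => (lt_or_ge i m).elim (G.iterate_lt h1 h2 hi) (fun hm => h i hm hic)⟩

/-- Points grafted to the left of `p`. -/
theorem fill (G : Gap n a b m p) {c : ℕ} {u : ℚ} (hu : Dy c u) (h1 : a ≤ p - (1 - u) / 2 ^ m)
    (h : ∀ i < c, tent^[i] u < p - (1 - u) / 2 ^ m) : Mx (c + m) (p - (1 - u) / 2 ^ m) := by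
  have hpos : (0 : ℚ) < (1 - u) / 2 ^ m := div_pos (by linarith [hu.lt_one]) (by positivity)
  refine G.mx_of_iterate_lt (G.mid.graft hu).1 h1 (by linarith [G.mid_lt]) fun i hi hic => ?_
  obtain ⟨k, rfl⟩ := Nat.exists_eq_add_of_le' hi
  rw [iterate_add_tent, (G.mid.iterate_graft hu.pos.le hu.lt_one.le).1]
  exact h k (by omega)

/-- The first return cannot come before time m, by `iterate_lt`. If it comes at a time j > m, the
truncation of z to order j is shift-maximal by `Dy.first_return`, and it cannot leave the left half
of the gap. -/
theorem first_return (G : Gap n a b m p) {c : ℕ} {z : ℚ} (hz : Dy c z) (hcn : c ≤ n) (h1 : a < z)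
    (h2 : z < p) (hnot : ¬ Mx c z) :
    (m < c ∧ z ≤ tent^[m] z) ∨
      ∃ j q, m < j ∧ j < c ∧ Mx j q ∧ a < q ∧ q < p ∧ z ≤ tent^[j] z := by
  classical
  have hex : ∃ j, 1 ≤ j ∧ j < c ∧ z ≤ tent^[j] z := by
    by_contra hcon
    refine hnot ⟨hz, fun i hi hic => ?_⟩
    by_contra h
    exact hcon ⟨i, hi, hic, not_lt.1 h⟩
  obtain ⟨hj, hjc, hr⟩ := Nat.find_spec hex
  have hmin := fun i => Nat.find_min (H := hex) (m := i)
  set j := Nat.find hex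
  have hmin' : ∀ i, 1 ≤ i → i < j → tent^[i] z < z := by
    intro i hi hij
    by_contra h
    exact hmin i hij ⟨hi, by omega, not_lt.1 h⟩
  have hjm : m ≤ j := by
    by_contra h
    exact absurd (G.iterate_lt h1.le (by linarith [G.mid_lt]) hj (by omega)) (not_lt.2 hr)
  rcases Nat.eq_or_lt_of_le hjm with h | hjm
  · left
    rw [h]; exact ⟨hjc, hr⟩
  right
  obtain ⟨q, hq, hzq⟩ := hz.trunc hj hjc
  refine ⟨j, q, hjm, hjc, hq.first_return hmin' hr hzq, ?_, ?_, hr⟩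
  -- If q < a < z, all three lie on the falling side of the tent over q, so T^j a > T^j z ≥ z > a,
  -- against the maximality of a.
  · by_contra hcon
    have hqa : q < a := lt_of_le_of_ne (not_lt.1 hcon) (hq.ne_of_order G.left.1 (by omega))
    have e1 : |z - q| = z - q := abs_of_pos (by linarith)
    have e2 : |a - q| = a - q := abs_of_pos (by linarith)
    rw [e1] at hzq
    have h3 := hq.peak (y := z) (by rw [e1]; exact hzq.le)
    have h4 := hq.peak (y := a) (by rw [e2]; linarith)
    rw [e1] at h3
    rw [e2] at h4
    have h5 := G.left.2 j hj (by omega)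
    have h6 : (2 : ℚ) ^ j * (a - q) < 2 ^ j * (z - q) :=
      mul_lt_mul_of_pos_left (by linarith) (by positivity)
    linarith
  · by_contra hcon
    have hne : p ≠ q := G.mid.ne_of_order hq (by omega)
    have hpq : p < q := lt_of_le_of_ne (not_lt.1 hcon) hne
    have h3 := hq.sep G.mid hjm.le hne
    rw [abs_of_neg (by linarith)] at h3 hzq
    linarith

end Gap

/-! ### Renormalization -/

/-- `Img p m k y x`: `x` is the image of `y`, a point of order `k`, under the renormalization
attached to `p`, a point of order `m`. -/
inductive Img (p : ℚ) (m : ℕ) : ℕ → ℚ → ℚ → Prop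
  | base : Img p m 1 (1 / 2) p
  | left {k : ℕ} {y x : ℚ} : Img p m k y x → Img p m (k + 1) (y / 2) (p - (1 - x) / 2 ^ m)
  | right {k : ℕ} {y x : ℚ} : Img p m k y x → Img p m (k + 1) (1 - y / 2) (p + (1 - x) / 2 ^ m)

namespace Img

variable {p : ℚ} {m k k' : ℕ} {y y' x x' : ℚ}

theorem dy_source (h : Img p m k y x) : Dy k y := by
  induction h with
  | base => exact .base
  | left _ ih => exact ih.left
  | right _ ih => exact ih.right

theorem dy (h : Img p m k y x) (hp : Dy m p) : Dy (k * m) x := by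
  induction h with
  | base => rwa [one_mul]
  | left _ ih => rw [add_mul, one_mul]; exact (hp.graft ih).1
  | right _ ih => rw [add_mul, one_mul]; exact (hp.graft ih).2

theorem order_eq (h : Img p m k y x) (hp : Dy m p) {c : ℕ} (hx : Dy c x) : c = k * m :=
  hx.order_unique (h.dy hp)

theorem near (h : Img p m k y x) (hp : Dy m p) : |x - p| < 1 / 2 ^ m := by
  have key : ∀ {x : ℚ} {c : ℕ}, Dy c x → 0 < (1 - x) / 2 ^ m ∧ (1 - x) / 2 ^ m < 1 / 2 ^ m := by
    intro x c hx
    refine ⟨div_pos (by linarith [hx.lt_one]) (by positivity), ?_⟩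
    gcongr; linarith [hx.pos]
  cases h with
  | base => rw [sub_self, abs_zero]; positivity
  | left h =>
    have := key (h.dy hp)
    rw [abs_lt]; constructor <;> linarith
  | right h =>
    have := key (h.dy hp)
    rw [abs_lt]; constructor <;> linarith

theorem exists_of_dy (p : ℚ) (m : ℕ) (h : Dy k y) : ∃ x, Img p m k y x := by
  induction h with
  | base => exact ⟨_, .base⟩
  | left _ ih => obtain ⟨x, hx⟩ := ih; exact ⟨_, hx.left⟩
  | right _ ih => obtain ⟨x, hx⟩ := ih; exact ⟨_, hx.right⟩

theorem lt_iff_aux (h : Img p m k y x) (h' : Img p m k' y' x') (hp : Dy m p) :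
    (y < y' → x < x') ∧ (y' < y → x' < x) := by
  have key : ∀ {x : ℚ} {c : ℕ}, Dy c x → 0 < (1 - x) / 2 ^ m :=
    fun hx => div_pos (by linarith [hx.lt_one]) (by positivity)
  have mono : ∀ {x x' : ℚ}, x < x' → (1 - x') / 2 ^ m < (1 - x) / 2 ^ m := by
    intro x x' h; gcongr
  induction h generalizing k' y' x' with
  | base =>
    cases h' with
    | base => exact ⟨fun h => absurd h (lt_irrefl _), fun h => absurd h (lt_irrefl _)⟩
    | left h' =>
      exact ⟨fun _ => by linarith [h'.dy_source.lt_one], fun _ => by linarith [key (h'.dy hp)]⟩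
    | right h' =>
      exact ⟨fun _ => by linarith [key (h'.dy hp)], fun _ => by linarith [h'.dy_source.lt_one]⟩
  | left h ih =>
    cases h' with
    | base =>
      exact ⟨fun _ => by linarith [key (h.dy hp)], fun _ => by linarith [h.dy_source.lt_one]⟩
    | left h' =>
      exact ⟨fun _ => by linarith [mono ((ih h').1 (by linarith))],
        fun _ => by linarith [mono ((ih h').2 (by linarith))]⟩
    | right h' =>
      exact ⟨fun _ => by linarith [key (h'.dy hp), key (h.dy hp)],
        fun _ => by linarith [h.dy_source.lt_one, h'.dy_source.lt_one]⟩
  | right h ih =>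
    cases h' with
    | base =>
      exact ⟨fun _ => by linarith [h.dy_source.lt_one], fun _ => by linarith [key (h.dy hp)]⟩
    | left h' =>
      exact ⟨fun _ => by linarith [h.dy_source.lt_one, h'.dy_source.lt_one],
        fun _ => by linarith [key (h'.dy hp), key (h.dy hp)]⟩
    | right h' =>
      exact ⟨fun _ => by linarith [mono ((ih h').2 (by linarith))],
        fun _ => by linarith [mono ((ih h').1 (by linarith))]⟩

theorem unique (h : Img p m k y x) (h' : Img p m k' y x') : x = x' := by
  induction h generalizing k' x' with
  | base =>
    generalize hy : (1 / 2 : ℚ) = y at h'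
    cases h' with
    | base => rfl
    | left h' => linarith [h'.dy_source.lt_one]
    | right h' => linarith [h'.dy_source.lt_one]
  | @left _ y0 _ h ih =>
    generalize hy : y0 / 2 = y at h'
    cases h' with
    | base => linarith [h.dy_source.lt_one]
    | left h' =>
      obtain rfl := ih (by rwa [show y0 = _ by linarith])
      rfl
    | right h' => linarith [h.dy_source.lt_one, h'.dy_source.lt_one]
  | @right _ y0 _ h ih =>
    generalize hy : 1 - y0 / 2 = y at h'
    cases h' with
    | base => linarith [h.dy_source.lt_one]
    | left h' => linarith [h.dy_source.lt_one, h'.dy_source.lt_one]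
    | right h' =>
      obtain rfl := ih (by rwa [show y0 = _ by linarith])
      rfl

theorem lt_iff_lt (h : Img p m k y x) (h' : Img p m k' y' x') (hp : Dy m p) :
    y < y' ↔ x < x' := by
  refine ⟨(h.lt_iff_aux h' hp).1, fun hx => ?_⟩
  rcases lt_trichotomy y y' with h1 | h1 | h1
  · exact h1
  · subst h1; exact absurd (h.unique h') hx.ne
  · exact absurd ((h.lt_iff_aux h' hp).2 h1) (not_lt.2 hx.le)

theorem le_iff_le (h : Img p m k y x) (h' : Img p m k' y' x') (hp : Dy m p) :
    y ≤ y' ↔ x ≤ x' := by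
  rw [← not_lt, ← not_lt, h'.lt_iff_lt h hp]

theorem step (h : Img p m (k + 1) y x) (hk : 1 ≤ k) (hp : Dy m p) :
    Img p m k (tent y) (tent^[m] x) := by
  generalize hn : k + 1 = n at h
  cases h with
  | base => omega
  | left h =>
    obtain rfl : k = _ := Nat.succ.inj hn
    rw [tent_half h.dy_source.lt_one.le, (hp.iterate_graft (h.dy hp).pos.le (h.dy hp).lt_one.le).1]
    exact h
  | right h =>
    obtain rfl : k = _ := Nat.succ.inj hn
    rw [tent_one_sub h.dy_source.lt_one.le,
      (hp.iterate_graft (h.dy hp).pos.le (h.dy hp).lt_one.le).2]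
    exact h

theorem iterate (h : Img p m k y x) (hp : Dy m p) {q : ℕ} (hq : q < k) :
    Img p m (k - q) (tent^[q] y) (tent^[q * m] x) := by
  induction q with
  | zero => simpa using h
  | succ q ih =>
    have h1 := ih (by omega)
    rw [show k - q = (k - (q + 1)) + 1 by omega] at h1
    have h2 := h1.step (by omega) hp
    rw [← iterate_add_tent] at h2
    rwa [Function.iterate_succ_apply', show (q + 1) * m = m + q * m by ring]

/-- Intermediate images of a renormalized point lie below all renormalized points. -/
theorem iterate_lt (hp : Mx m p) {j : ℕ} (h : Img p m k y x) (h' : Img p m k' y' x') (hj : 1 ≤ j)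
    (hjm : j < m) : tent^[j] x < x' := by
  induction hN : k + k' using Nat.strong_induction_on generalizing k k' y y' x x' j with
  | _ N IH =>
  have hd := hp.1.iterate hjm
  have hs := hp.2 j hj hjm
  have hsep := hp.1.sep hd (by omega) hs.ne
  rw [abs_of_neg (by linarith)] at hsep
  have hx := h.near hp.1
  have hx' := h'.near hp.1
  have hsx' : tent^[j] p < x' := by linarith [(abs_lt.1 hx').1]
  by_contra hcon
  have hle : x' ≤ tent^[j] x := not_lt.1 hcon
  have hxp : x ≠ p := by rintro rfl; linarith
  have hk : k ≠ 1 := by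
    rintro rfl
    exact hxp ((h.dy_source.one_eq ▸ h).unique .base)
  have hk1 := h.dy_source.pos_order
  have habs := hp.1.abs_iterate_sub hjm hx.le
  have hpow : (2 : ℚ) ^ j * (1 / 2 ^ m) = 1 / 2 ^ (m - j) := by
    obtain ⟨d, rfl⟩ := Nat.exists_eq_add_of_le hjm.le
    rw [Nat.add_sub_cancel_left, pow_add]; field_simp
  have hclose : |tent^[j] x - tent^[j] p| < 1 / 2 ^ (m - j) := by
    rw [habs, ← hpow]
    exact mul_lt_mul_of_pos_left hx (by positivity)
  have e1 : |tent^[j] x - tent^[j] p| = tent^[j] x - tent^[j] p := abs_of_pos (by linarith)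
  have e2 : |x' - tent^[j] p| = x' - tent^[j] p := abs_of_pos (by linarith)
  have h3 := hd.peak hclose.le
  have h4 := hd.peak (y := x') (by rw [e2]; rw [e1] at hclose; linarith)
  rw [← iterate_add_tent, Nat.sub_add_cancel hjm.le, e1] at h3
  rw [e2] at h4
  -- Right of T^j p the iterate T^(m-j) decreases, so T^m x ≤ T^(m-j) x'. But T^m x is renormalized
  -- of smaller order, so this is a counterexample with the two points exchanged and `k + k'`
  -- smaller.
  have h5 : (2 : ℚ) ^ (m - j) * (x' - tent^[j] p) ≤ 2 ^ (m - j) * (tent^[j] x - tent^[j] p) :=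
    mul_le_mul_of_nonneg_left (by linarith) (by positivity)
  obtain ⟨k, rfl⟩ : ∃ i, k = i + 1 := ⟨k - 1, by omega⟩
  have h6 := h.step (by omega) hp.1
  have h7 := IH (k' + k) (by omega) h' h6 (j := m - j) (by omega) (by omega) rfl
  linarith

/-- Images at multiples of m correspond to images of the source, and the order is preserved; the
other images never matter, by `iterate_lt`. -/
theorem mx_iff (hp : Mx m p) (h : Img p m k y x) : Mx k y ↔ Mx (k * m) x := by
  have hm := hp.1.pos_order
  constructor
  · intro hy
    refine ⟨h.dy hp.1, fun i hi hik => ?_⟩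
    have hq : i / m < k := Nat.div_lt_of_lt_mul (by rwa [mul_comm])
    have hit := h.iterate hp.1 hq
    have e : tent^[i] x = tent^[i % m] (tent^[i / m * m] x) := by
      rw [← iterate_add_tent, Nat.mod_add_div']
    rw [e]
    rcases Nat.eq_zero_or_pos (i % m) with h0 | h0
    · rw [h0]
      have hq1 : 1 ≤ i / m := by
        refine Nat.pos_of_ne_zero fun hc => ?_
        have := Nat.mod_add_div' i m
        rw [h0, hc, zero_mul] at this
        exact absurd hi (by rw [← this]; exact Nat.not_succ_le_zero 0)
      exact (hit.lt_iff_lt h hp.1).1 (hy.2 _ hq1 hq)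
    · exact hit.iterate_lt hp h h0 (Nat.mod_lt _ hm)
  · intro hx
    refine ⟨h.dy_source, fun q hq hqk => ?_⟩
    refine ((h.iterate hp.1 hqk).lt_iff_lt h hp.1).2 (hx.2 _ (Nat.mul_pos hq hm) ?_)
    exact Nat.mul_lt_mul_of_pos_right hqk hm

/-- Grafting commutes with renormalization. -/
theorem graft {l : ℕ} {w v : ℚ} (h : Img p m k y x) (h' : Img p m l w v) :
    Img p m (l + k) (y - (1 - w) / 2 ^ k) (x - (1 - v) / 2 ^ (k * m)) ∧
      Img p m (l + k) (y + (1 - w) / 2 ^ k) (x + (1 - v) / 2 ^ (k * m)) := by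
  induction h with
  | base =>
    rw [one_mul]
    constructor
    · convert h'.left using 1; ring
    · convert h'.right using 1; ring
  | @left k y x h ih =>
    rw [← add_assoc, add_mul, one_mul, pow_add, pow_succ]
    constructor
    · convert ih.1.left using 1; field_simp; ring
    · convert ih.2.left using 1; field_simp; ring
  | @right k y x h ih =>
    rw [← add_assoc, add_mul, one_mul, pow_add, pow_succ]
    constructor
    · convert ih.2.right using 1 <;> field_simp <;> ring
    · convert ih.1.right using 1 <;> field_simp <;> ring

/-- Renormalizations compose. -/
theorem comp {l : ℕ} {z w : ℚ} (h : Img p m k y x) (h' : Img y k l z w) :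
    ∃ v, Img p m (l * k) w v ∧ Img x (k * m) l z v := by
  induction h' with
  | base => exact ⟨x, by rwa [one_mul], .base⟩
  | left h' ih =>
    obtain ⟨v, h1, h2⟩ := ih
    exact ⟨_, by rw [add_mul, one_mul]; exact (h.graft h1).1, h2.left⟩
  | right h' ih =>
    obtain ⟨v, h1, h2⟩ := ih
    exact ⟨_, by rw [add_mul, one_mul]; exact (h.graft h1).2, h2.right⟩

theorem half (h : Dy k y) : Img (1 / 2) 1 k y y := by
  induction h with
  | base => exact .base
  | left _ ih => convert ih.left using 1; ring
  | right _ ih => convert ih.right using 1; ring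

/-- A point all of whose images return near `p` is renormalized. -/
theorem exists_of_returns {c : ℕ} {z e : ℚ} (hp : Dy m p) (hz : Dy c z) (hze : |z - p| ≤ e)
    (he : e < 1 / 2 ^ m) (hret : p - e ≤ 1 - 2 ^ m * e)
    (hle : ∀ i, 1 ≤ i → i < c → tent^[i] z ≤ p + e) : ∃ k y, Img p m k y z := by
  induction c using Nat.strong_induction_on generalizing z with
  | _ c IH =>
  by_cases hne : z = p
  · subst hne; exact ⟨_, _, .base⟩
  have hmc : m < c := by
    by_contra hcm
    have := hp.sep hz (by omega) hne
    linarith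
  have hd := hz.iterate hmc
  have hm := hp.pos_order
  have h1 := hp.peak (hze.trans he.le)
  have h2 : (2 : ℚ) ^ m * |z - p| ≤ 2 ^ m * e := mul_le_mul_of_nonneg_left hze (by positivity)
  -- The point T^m z = 1 - 2^m |z - p| is again in [p - e, p + e]: from below by `hret`, from above
  -- by `hle`. So one block of length m can be peeled off.
  obtain ⟨k, y, hk⟩ := IH (c - m) (by omega) hd
    (by
      rw [abs_le]
      exact ⟨by linarith, by linarith [hle m hm hmc]⟩)
    (fun i hi hic => by
      rw [← iterate_add_tent]
      exact hle _ (by omega) (by omega))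
  have h3 := hp.abs_sub_eq (hze.trans he.le)
  rcases abs_choice (z - p) with h4 | h4
  · refine ⟨k + 1, 1 - y / 2, ?_⟩
    have := hk.right
    rwa [show p + (1 - tent^[m] z) / 2 ^ m = z by linarith] at this
  · refine ⟨k + 1, y / 2, ?_⟩
    have := hk.left
    rwa [show p - (1 - tent^[m] z) / 2 ^ m = z by linarith] at this

/-- For x on the right of p the right-hand side is T^m x, and the claim says that the left graft of
T^m x is at most T^m x; on the sources this is y / 2 ≤ y. -/
theorem return_le (h : Img p m k y x) (hp : Dy m p) (hpx : p < x) :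
    p - (x - p) ≤ 1 - 2 ^ m * (x - p) := by
  cases h with
  | base => exact absurd hpx (lt_irrefl _)
  | @left _ _ x h =>
    have : 0 < (1 - x) / 2 ^ m := div_pos (by linarith [(h.dy hp).lt_one]) (by positivity)
    linarith
  | right h =>
    have h1 := (h.left.le_iff_le h hp).1 (by linarith [h.dy_source.pos])
    have hpos : (2 : ℚ) ^ m ≠ 0 := by positivity
    rw [add_sub_cancel_left, mul_div_cancel₀ _ hpos]
    linarith

/-- A shift-maximal point between `p` and a renormalized point is renormalized. -/
theorem of_between {c : ℕ} {t : ℚ} (h : Img p m k y x) (hp : Dy m p) (ht : Mx c t) (h1 : p < t)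
    (h2 : t ≤ x) : ∃ k y, Img p m k y t := by
  have hx := (abs_lt.1 (h.near hp)).2
  refine exists_of_returns hp ht.1 (e := t - p) ?_ (by linarith) ?_ ?_
  · rw [abs_of_pos (by linarith)]
  · have h3 := h.return_le hp (h1.trans_le h2)
    have hpos : (1 : ℚ) ≤ 2 ^ m := one_le_pow₀ (by norm_num)
    -- Replacing x by the smaller t changes the difference of the two sides by (2^m - 1)(x - t) ≥ 0.
    nlinarith [mul_nonneg (sub_nonneg.2 hpos) (sub_nonneg.2 h2)]
  · intro i hi hic
    linarith [ht.2 i hi hic]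

end Img

/-! ### Special points -/

theorem dy_top (k : ℕ) : Dy (k + 1) (1 / 2 ^ (k + 1)) ∧ Dy (k + 1) (1 - 1 / 2 ^ (k + 1)) := by
  have h : ∀ k, Dy (k + 1) (1 / 2 ^ (k + 1)) := by
    intro k
    induction k with
    | zero => simpa using Dy.base
    | succ k ih => rw [inv_pow_succ]; exact ih.left
  refine ⟨h k, ?_⟩
  rcases k with _ | k
  · convert Dy.base using 1; norm_num
  · rw [inv_pow_succ]; exact (h k).right

theorem iterate_inv_pow {k j : ℕ} (hj : j ≤ k) :
    tent^[j] (1 / 2 ^ (k + 1)) = 1 / 2 ^ (k + 1 - j) := by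
  induction j with
  | zero => rfl
  | succ j ih =>
    rw [Function.iterate_succ_apply', ih (by omega), show k + 1 - j = (k - j) + 1 by omega,
      inv_pow_succ, tent_half, show k + 1 - (j + 1) = k - j by omega]
    exact (div_le_one (by positivity)).2 (one_le_pow₀ (by norm_num))

/-- The greatest shift-maximal point of a given order. -/
theorem mx_top {n : ℕ} (hn : 1 ≤ n) : Mx n (1 - 1 / 2 ^ n) := by
  obtain ⟨k, rfl⟩ : ∃ k, n = k + 1 := ⟨n - 1, by omega⟩
  refine ⟨(dy_top k).2, fun i hi hik => ?_⟩
  obtain ⟨i, rfl⟩ : ∃ j, i = j + 1 := ⟨i - 1, by omega⟩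
  obtain ⟨k, rfl⟩ : ∃ j, k = j + 1 := ⟨k - 1, by omega⟩
  rw [iterate_succ_tent, inv_pow_succ, tent_one_sub, iterate_inv_pow (by omega)]
  · have h1 := inv_pow_le (show 1 ≤ k + 1 - i by omega)
    have h2 := inv_pow_le (show 1 ≤ k + 1 by omega)
    norm_num at h1 h2 ⊢
    linarith
  · exact (div_le_one (by positivity)).2 (one_le_pow₀ (by norm_num))

theorem Dy.le_top {k n : ℕ} {y : ℚ} (h : Dy k y) (hk : k ≤ n) : y ≤ 1 - 1 / 2 ^ n := by
  linarith [h.bounds.2, inv_pow_le hk]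

theorem Dy.lt_top {k n : ℕ} {y : ℚ} (h : Dy k y) (hk : k < n) : y < 1 - 1 / 2 ^ n := by
  refine lt_of_le_of_ne (h.le_top hk.le) (h.ne_of_order (mx_top (by omega)).1 (by omega))

/-- 2/3 is the fixed point of the tent map: a point of (0, 2/3] does not exceed its image. -/
theorem Mx.two_thirds_lt {n : ℕ} {x : ℚ} (h : Mx n x) (hn : 2 ≤ n) : 2 / 3 < x := by
  have h1 := h.2 1 le_rfl (by omega)
  have hx := h.1.pos
  change tent x < x at h1
  rcases le_total x (1 / 2) with h2 | h2
  · rw [tent_left h2] at h1; linarith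
  · rw [tent_right h2] at h1; linarith

theorem dy_three_quarters : Dy 2 (3 / 4) := by
  convert Dy.base.right using 1; norm_num

theorem mx_three_quarters : Mx 2 (3 / 4) := by
  convert mx_top (n := 2) (by norm_num) using 1; norm_num

theorem Mx.half_le {n : ℕ} {x : ℚ} (h : Mx n x) : 1 / 2 ≤ x := by
  rcases Nat.lt_or_ge n 2 with h1 | h1
  · have := h.1.pos_order
    obtain rfl : n = 1 := by omega
    exact h.1.one_eq.ge
  · linarith [h.two_thirds_lt h1]

theorem Mx.three_quarters_lt {n : ℕ} {x : ℚ} (h : Mx n x) (hn : 3 ≤ n) : 3 / 4 < x := by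
  have h0 := h.two_thirds_lt (by omega)
  have h1 := h.2 2 (by omega) (by omega)
  have hne : 3 / 4 ≠ x := dy_three_quarters.ne_of_order h.1 (by omega)
  by_contra hcon
  have hlt : x < 3 / 4 := lt_of_le_of_ne (not_lt.1 hcon) hne.symm
  have h2 : |x - 3 / 4| = 3 / 4 - x := by rw [abs_of_neg (by linarith)]; ring
  have h3 := dy_three_quarters.peak (y := x) (by rw [h2]; norm_num; linarith)
  rw [h2] at h3
  rw [h3] at h1
  linarith

theorem Mx.three_quarters_le {n : ℕ} {x : ℚ} (h : Mx n x) (hn : 2 ≤ n) : 3 / 4 ≤ x := by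
  rcases Nat.lt_or_ge n 3 with h1 | h1
  · obtain rfl : n = 2 := by omega
    have h2 := h.two_thirds_lt le_rfl
    by_contra hcon
    have h3 := dy_three_quarters.sep h.1 le_rfl (by rintro rfl; exact hcon le_rfl)
    rw [abs_of_neg (by linarith)] at h3
    norm_num at h3
    linarith
  · exact (h.three_quarters_lt h1).le

/-- The bound 5/6 = 3/4 + 1/12 comes from the return condition 3/4 - e ≤ 1 - 4e, that is, e ≤ 1/12.
-/
theorem Mx.img_three_quarters {n : ℕ} {x : ℚ} (h : Mx n x) (hn : 2 ≤ n) (hx : x ≤ 5 / 6) :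
    ∃ k y, Img (3 / 4) 2 k y x := by
  have h1 := h.three_quarters_le hn
  refine Img.exists_of_returns dy_three_quarters h.1 (e := x - 3 / 4) ?_ ?_ ?_ ?_
  · rw [abs_of_nonneg (by linarith)]
  · norm_num; linarith
  · norm_num; linarith
  · intro i hi hin
    linarith [h.2 i hi hin]

/-- The point with itinerary `R^q C`. -/
def alt (q : ℕ) : ℚ := 2 / 3 - 1 / 6 * (-1 / 2) ^ q

theorem alt_zero : alt 0 = 1 / 2 := by norm_num [alt]

theorem alt_succ (q : ℕ) : alt (q + 1) = 1 - alt q / 2 := by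
  unfold alt; rw [pow_succ]; ring

theorem dy_alt (q : ℕ) : Dy (q + 1) (alt q) := by
  induction q with
  | zero => rw [alt_zero]; exact .base
  | succ q ih => rw [alt_succ]; exact ih.right

theorem iterate_alt {q j : ℕ} (hj : j ≤ q) : tent^[j] (alt q) = alt (q - j) := by
  induction j with
  | zero => rfl
  | succ j ih =>
    rw [Function.iterate_succ_apply', ih (by omega), show q - j = (q - (j + 1)) + 1 by omega,
      alt_succ, tent_one_sub (dy_alt _).lt_one.le]

theorem abs_neg_half_pow (q : ℕ) : |(-1 / 2 : ℚ) ^ q| = 1 / 2 ^ q := by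
  rw [abs_pow, show |(-1 / 2 : ℚ)| = 1 / 2 by norm_num, one_div, inv_pow, one_div]

theorem alt_mem (q : ℕ) : 1 / 2 ≤ alt q ∧ alt q ≤ 3 / 4 := by
  induction q with
  | zero => rw [alt_zero]; norm_num
  | succ q ih => rw [alt_succ]; constructor <;> linarith [ih.1, ih.2]

/-- The point with itinerary `R L R^q C`. -/
def zig (q : ℕ) : ℚ := 1 - alt q / 4

theorem zig_eq (q : ℕ) : zig q = 5 / 6 + 1 / 24 * (-1 / 2) ^ q := by unfold zig alt; ring

theorem zig_eq' (q : ℕ) : zig q = 1 - (alt q / 2) / 2 := by unfold zig; ring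

theorem iterate_zig (q j : ℕ) : tent^[j + 2] (zig q) = tent^[j] (alt q) := by
  have h := alt_mem q
  rw [show j + 2 = j + 1 + 1 from rfl, iterate_succ_tent, iterate_succ_tent, zig_eq',
    tent_one_sub (by linarith), tent_half (by linarith)]

theorem mx_zig (q : ℕ) : Mx (q + 3) (zig q) := by
  have h := alt_mem q
  refine ⟨by rw [zig_eq']; exact (dy_alt q).left.right, fun i hi hiq => ?_⟩
  have h1 : 13 / 16 ≤ zig q := by unfold zig; linarith
  rcases i with _ | _ | j
  · omega
  · change tent (zig q) < _
    rw [zig_eq', tent_one_sub (by linarith)]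
    rw [zig_eq'] at h1
    linarith
  · rw [show j + 1 + 1 = j + 2 from rfl, iterate_zig, iterate_alt (by omega)]
    linarith [(alt_mem (q - j)).2]

/-- `zig q` exceeds 5/6 by at most 2⁻ᵠ/24, less than the distance 2⁻ᵠ/8 that separates distinct
points of order at most q + 3. So no such point fits between. -/
theorem zig_le {c q : ℕ} {x : ℚ} (hx : Dy c x) (hc : c ≤ q + 3) (h : 5 / 6 < x) : zig q ≤ x := by
  by_contra hcon
  have h1 := (mx_zig q).1.sep hx hc (by rintro rfl; exact hcon le_rfl)
  rw [abs_of_neg (by linarith), zig_eq] at h1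
  have h2 := le_abs_self ((-1 / 2 : ℚ) ^ q)
  rw [abs_neg_half_pow] at h2
  rw [pow_add] at h1
  have h3 : (1 : ℚ) / (2 ^ q * 2 ^ 3) = 1 / 8 * (1 / 2 ^ q) := by field_simp; norm_num
  have h4 := inv_pow_pos q
  linarith

/-! ### Neighbours -/

theorem exists_mx_pred {n : ℕ} {p : ℚ} (h : ∃ x, Mx n x ∧ x < p) :
    ∃ x, Mx n x ∧ x < p ∧ ∀ y, Mx n y → y < p → y ≤ x := by
  have hf : {x | Mx n x ∧ x < p}.Finite := (Dy.finite n).subset fun x hx => hx.1.1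
  obtain ⟨x, hx, H⟩ := Set.exists_max_image _ id hf h
  exact ⟨x, hx.1, hx.2, fun y h1 h2 => H y ⟨h1, h2⟩⟩

theorem exists_mx_succ {n : ℕ} {p : ℚ} (h : ∃ x, Mx n x ∧ p < x) :
    ∃ x, Mx n x ∧ p < x ∧ ∀ y, Mx n y → p < y → x ≤ y := by
  have hf : {x | Mx n x ∧ p < x}.Finite := (Dy.finite n).subset fun x hx => hx.1.1
  obtain ⟨x, hx, H⟩ := Set.exists_min_image _ id hf h
  exact ⟨x, hx.1, hx.2, fun y h1 h2 => H y ⟨h1, h2⟩⟩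

/-! ### Gaps under renormalization -/

namespace Gap

variable {n m : ℕ} {a b p : ℚ}

theorem right_le (G : Gap n a b m p) {x : ℚ} (hx : Mx n x) (h : a < x) : b ≤ x := by
  by_contra hcon
  exact G.free x hx h (not_le.1 hcon)

/-- A gap inside a renormalization window is the image of a gap. -/
theorem renorm (G : Gap n a b m p) {l k : ℕ} {q y : ℚ} (hq : Mx l q) (hqa : q < a)
    (hp : Img q l k y p) :
    ∃ n' a' b', Img q l n' a' a ∧ Gap n' a' b' k y ∧ m = k * l ∧ n = n' * l := by
  obtain ⟨n', a', ha⟩ := hp.of_between hq.1 G.left hqa G.lt_mid.le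
  have hm := hp.order_eq hq.1 G.mid
  have hn := ha.order_eq hq.1 G.left.1
  have hl := hq.1.pos_order
  have hkn : k < n' := by
    have := G.order_lt
    rw [hm, hn] at this
    exact lt_of_mul_lt_mul_right this (Nat.zero_le _)
  -- The image of the greatest point of order `n'` lies to the right of p because k < n'. It is
  -- therefore at least b, which puts b inside the renormalization window.
  have htop := mx_top (show 1 ≤ n' by omega)
  obtain ⟨x, hx⟩ := Img.exists_of_dy q l htop.1
  have hpx : p < x := (hp.lt_iff_lt hx hq.1).1 (hp.dy_source.lt_top hkn)
  have hbx : b ≤ x := G.right_le (hn ▸ (hx.mx_iff hq).1 htop) (G.lt_mid.trans hpx)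
  obtain ⟨n'', b', hb⟩ := hx.of_between hq.1 G.right (hqa.trans (G.lt_mid.trans G.mid_lt)) hbx
  obtain rfl : n' = n'' := by
    have := hb.order_eq hq.1 G.right.1
    exact Nat.eq_of_mul_eq_mul_right hl (hn.symm.trans this)
  have hab : a' < b' := (ha.lt_iff_lt hb hq.1).2 (G.lt_mid.trans G.mid_lt)
  obtain ⟨k', y', G'⟩ := exists_gap (n := n') (a := a') (b := b')
    ((ha.mx_iff hq).2 (hn ▸ G.left)) ((hb.mx_iff hq).2 (hn ▸ G.right)) hab (by
      intro z hz h1 h2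
      obtain ⟨w, hw⟩ := Img.exists_of_dy q l hz.1
      exact G.free w (hn ▸ (hw.mx_iff hq).1 hz) ((ha.lt_iff_lt hw hq.1).1 h1)
        ((hw.lt_iff_lt hb hq.1).1 h2))
  obtain ⟨w, hw⟩ := Img.exists_of_dy q l G'.mid
  have h1 := (G.order_le (hw.dy hq.1) ((ha.lt_iff_lt hw hq.1).1 G'.lt_mid)
    ((hw.lt_iff_lt hb hq.1).1 G'.mid_lt)).1
  have h2 := G'.order_le hp.dy_source ((ha.lt_iff_lt hp hq.1).2 G.lt_mid)
    ((hp.lt_iff_lt hb hq.1).2 G.mid_lt)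
  rw [hm] at h1
  have h3 : k = k' := le_antisymm (le_of_mul_le_mul_right h1 hl) h2.1
  subst h3
  have h4 := h2.2 rfl
  subst h4
  exact ⟨n', a', b', ha, G', hm, hn⟩

end Gap

/-! ### Symmetry of gaps -/

namespace Gap

variable {n m : ℕ} {a b p : ℚ}

theorem mirror_mx_of_le (G : Gap n a b m p) (h : 2 * p - a ≤ b) : Mx n (2 * p - a) := by
  have hab := (G.lt_mid.trans G.mid_lt).le
  obtain ⟨hd, hi⟩ := G.mid.mirror G.left.1 G.order_lt (G.abs_lt le_rfl hab).le
  have h1 := G.lt_mid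
  refine G.mx_of_iterate_lt hd (by linarith) h fun i him hin => ?_
  rw [hi i him]
  have := G.left.2 i (G.mid.pos_order.trans him) hin
  linarith

theorem img_of_return (G : Gap n a b m p) {c : ℕ} {x : ℚ} (hx : Mx c x) (h1 : p < x) (h2 : x < b)
    (hr : 2 * p - x ≤ tent^[m] x) : ∃ k y, Img p m k y x := by
  have h3 := G.abs_lt (G.lt_mid.trans h1).le h2.le
  have e : |x - p| = x - p := abs_of_pos (by linarith)
  have h4 := G.mid.peak h3.le
  rw [e] at h3 h4
  refine Img.exists_of_returns G.mid hx.1 (e := x - p) e.le h3 (by linarith) fun i hi hic => ?_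
  linarith [hx.2 i hi hic]

theorem img_right_of_return (G : Gap n a b m p) (hr : 2 * p - b ≤ tent^[m] b) :
    ∃ k y, Img p m k y b := by
  have h1 := G.mid_lt
  have h3 := G.abs_lt (G.lt_mid.trans h1).le le_rfl
  have e : |b - p| = b - p := abs_of_pos (by linarith)
  have h4 := G.mid.peak h3.le
  rw [e] at h3 h4
  refine Img.exists_of_returns G.mid G.right.1 (e := b - p) e.le h3 (by linarith) fun i hi hic => ?_
  linarith [G.right.2 i hi hic]

/-- A gap is symmetric about its middle point, provided that all shift-maximal points in its left
half have large order. -/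
theorem symm_of_orders (G : Gap n a b m p)
    (W : ∀ c t, Mx c t → a < t → t < p → n < c + m) (hmn : ¬ m ∣ n) : 2 * p - a = b := by
  have h1 := G.lt_mid
  have h2 := G.mid_lt
  rcases lt_trichotomy (2 * p - a) b with h | h | h
  · exact (G.free _ (G.mirror_mx_of_le h.le) (by linarith) h).elim
  · exact h
  · exfalso
    obtain ⟨hd, hi⟩ := G.mid.mirror G.right.1 G.order_lt (G.abs_lt (h1.trans h2).le le_rfl).le
    -- The point 2p - b lies between a and p, so it is not shift-maximal. A return at time m makes b
    -- renormalized, whence m ∣ n. A return at j > m gives a shift-maximal q of order j with n < j +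
    -- m, whereas T^j b, of order n - j, falls inside the gap and so n - j ≥ m.
    rcases G.first_return hd le_rfl (by linarith) (by linarith)
      (fun hz => G.free _ hz (by linarith) (by linarith)) with ⟨-, hr⟩ | ⟨j, q, hmj, hjn, hq, h3, h4, hr⟩
    · rw [hi m le_rfl] at hr
      obtain ⟨k, y, hk⟩ := G.img_right_of_return hr
      exact hmn ⟨k, by rw [hk.order_eq G.mid G.right.1, mul_comm]⟩
    · have h5 := W j q hq h3 h4
      rw [hi j hmj.le] at hr
      have h6 := (G.order_le (G.right.1.iterate hjn) (by linarith)
        (G.right.2 j (by omega) hjn)).1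
      omega

/-- Shift-maximal points in the left half of a gap have large order. -/
theorem lt_order_add (G : Gap n a b m p) :
    ∀ c t, Mx c t → a < t → t < p → n < c + m := by
  induction n using Nat.strong_induction_on generalizing m a b p with
  | _ n IH =>
  intro c t ht hat htp
  by_contra hcon
  have htb := htp.trans G.mid_lt
  have hmc : m < c := by
    have h := G.order_le ht.1 hat htb
    rcases Nat.eq_or_lt_of_le h.1 with h1 | h1
    · exact absurd (h.2 h1.symm) htp.ne
    · exact h1
  have hm2 : 2 ≤ m := by
    by_contra hm
    have := G.mid.pos_order
    obtain rfl : m = 1 := by omega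
    have := G.mid.one_eq
    linarith [ht.half_le]
  have hpmx := G.mx_mid
  -- If p is renormalized from some q < a of order at least 2, so are a, b and t, and the induction
  -- hypothesis applies to the source gap.
  have R : ∀ l q k y, Mx l q → 2 ≤ l → q < a → Img q l k y p → False := by
    intro l q k y hq hl hqa hp
    obtain ⟨n', a', b', ha', G', e1, e2⟩ := G.renorm hq hqa hp
    obtain ⟨c', t', ht'⟩ := hp.of_between hq.1 ht (hqa.trans hat) htp.le
    have e3 := ht'.order_eq hq.1 ht.1
    have hn' := G'.left.1.pos_order
    have hlt : n' < n := by rw [e2]; nlinarith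
    have h1 := IH n' hlt G' c' t' ((ht'.mx_iff hq).2 (e3 ▸ ht)) ((ha'.lt_iff_lt ht' hq.1).2 hat)
      ((ht'.lt_iff_lt hp hq.1).2 htp)
    apply hcon
    rw [e1, e2, e3, ← add_mul]
    exact Nat.mul_lt_mul_of_pos_right h1 (by omega)
  obtain ⟨n', rfl⟩ : ∃ n', n = n' + m := ⟨n - m, by omega⟩
  -- Such an x exceeds T^m x, so its graft to the left of p lies to the right of x; the graft would
  -- be a shift-maximal point of order n inside the gap.
  have E : ∀ x, Mx n' x → a < x → x < p → False := by
    intro x hx h1 h2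
    have h3 := hx.2 m (by omega) (by omega)
    have h4 := G.abs_lt h1.le (h2.trans G.mid_lt).le
    have h5 := G.mid.abs_sub_eq h4.le
    rw [abs_of_neg (by linarith)] at h5
    have h6 : (1 - x) / 2 ^ m < (1 - tent^[m] x) / 2 ^ m := by gcongr
    have h7 : 0 < (1 - x) / 2 ^ m := div_pos (by linarith [hx.1.lt_one]) (by positivity)
    refine G.free _ (G.fill hx.1 (by linarith) fun i hi => ?_) (by linarith) (by linarith [G.mid_lt])
    linarith [hx.iterate_le hi]
  have hcn : c < n' := by
    rcases Nat.eq_or_lt_of_le (show c ≤ n' by omega) with h | h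
    · exact (E t (h ▸ ht) hat htp).elim
    · exact h
  rcases le_or_gt p (5 / 6) with h56 | h56
  · obtain ⟨k, y, hk⟩ := hpmx.img_three_quarters hm2 h56
    exact R 2 _ k y mx_three_quarters le_rfl (G.left.three_quarters_lt (by omega)) hk
  have hz : Mx n' (zig (n' - 3)) := by
    have := mx_zig (n' - 3)
    rwa [show n' - 3 + 3 = n' by omega] at this
  -- The comparison gap: the neighbours of p among the shift-maximal points of order n - m.
  obtain ⟨a1, ha1, ha1p, ha1m⟩ := exists_mx_pred (n := n') (p := p) ⟨_, hz,
    lt_of_le_of_ne (zig_le G.mid (by omega) h56) (hz.1.ne_of_order G.mid (by omega))⟩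
  obtain ⟨b1, hb1, hpb1, hb1m⟩ := exists_mx_succ (n := n') (p := p) ⟨_, mx_top (by omega),
    G.mid.lt_top (by omega)⟩
  obtain ⟨m1, p1, G1⟩ := exists_gap ha1 hb1 (ha1p.trans hpb1) (by
    intro x hx h1 h2
    rcases lt_trichotomy x p with h3 | h3 | h3
    · exact absurd (ha1m x hx h3) (not_le.2 h1)
    · exact absurd h3 (hx.1.ne_of_order G.mid (by omega))
    · exact absurd (hb1m x hx h3) (not_le.2 h2))
  have IH1 := IH n' (by omega) G1
  have ha1a : a1 < a := by
    by_contra h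
    have hne : a ≠ a1 := G.left.1.ne_of_order ha1.1 (by omega)
    exact E a1 ha1 (lt_of_le_of_ne (not_lt.1 h) hne) ha1p
  have hpe : p - (1 - a1) / 2 ^ m ≤ a := by
    by_contra h
    have h7 : 0 < (1 - a1) / 2 ^ m := div_pos (by linarith [ha1.1.lt_one]) (by positivity)
    refine G.free _ (G.fill ha1.1 (by linarith) fun i hi => ?_) (by linarith) (by linarith [G.mid_lt])
    linarith [ha1.iterate_le hi]
  have hw : a1 < tent^[m] t := by
    have h5 := G.mid.abs_sub_eq (G.abs_lt hat.le htb.le).le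
    rw [abs_of_neg (by linarith)] at h5
    have h6 : (1 - tent^[m] t) / 2 ^ m < (1 - a1) / 2 ^ m := by linarith
    have h7 := (div_lt_div_iff_of_pos_right (show (0 : ℚ) < 2 ^ m by positivity)).1 h6
    linarith
  -- The largest image w of t from time m on is shift-maximal, of order at most c - m, and lies
  -- between `a1` and t. The induction hypothesis for the comparison gap keeps it out of the left
  -- half of that gap.
  obtain ⟨j, hj, hom, hot⟩ := (ht.1.iterate hmc).exists_max
  have hot0 : tent^[m] t ≤ tent^[j + m] t := by
    rw [iterate_add_tent]
    exact hot 0 (by omega)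
  rw [← iterate_add_tent] at hom
  have hwt : tent^[j + m] t < t := ht.2 _ (by omega) (by omega)
  set w := tent^[j + m] t
  have ha1w : a1 < w := hw.trans_le hot0
  have hm1 := G1.order_le G.mid ha1p hpb1
  rcases le_or_gt p p1 with hpp | hpp
  · have := IH1 _ w hom ha1w (by linarith)
    omega
  have hm1m : m1 < m := by
    rcases Nat.eq_or_lt_of_le hm1.1 with h | h
    · exact absurd (hm1.2 h.symm) hpp.ne'
    · exact h
  have hp1a : p1 < a := by
    by_contra h
    have hne : a ≠ p1 := G.left.1.ne_of_order G1.mid (by omega)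
    have := (G.order_le G1.mid (lt_of_le_of_ne (not_lt.1 h) hne) (hpp.trans G.mid_lt)).1
    omega
  have hm12 : 2 ≤ m1 := by
    by_contra hm
    have := G1.mid.pos_order
    obtain rfl : m1 = 1 := by omega
    have := G1.mid.one_eq
    linarith [ha1.half_le, G1.lt_mid]
  rcases lt_or_ge w p1 with hwp | hwp
  · have := IH1 _ w hom ha1w hwp
    omega
  rcases lt_or_ge n' (m + m1) with hsub | hsub
  · have := (G1.order_le hom.1 ha1w (by linarith)).1
    omega
  by_cases hno : ∃ k y, Img p1 m1 k y p
  · obtain ⟨k, y, hk⟩ := hno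
    exact R m1 p1 k y G1.mx_mid hm12 hp1a hk
  -- If `m1` divided `n'`, the renormalization window of `p1` would reach `b1`, beyond p, and p
  -- would be renormalized from `p1`.
  have hdiv : ¬ m1 ∣ n' := by
    rintro ⟨d, hd⟩
    have hd2 : 1 < d := by
      have := G1.order_lt
      rw [hd] at this
      exact Nat.one_lt_iff_ne_zero_and_ne_one.2 ⟨by rintro rfl; omega, by rintro rfl; omega⟩
    have htop := mx_top (show 1 ≤ d by omega)
    obtain ⟨x, hx⟩ := Img.exists_of_dy p1 m1 htop.1
    have h1 : p1 < x := (Img.base.lt_iff_lt hx G1.mid).1 (Dy.base.lt_top hd2)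
    have h2 := (hx.mx_iff G1.mx_mid).1 htop
    rw [mul_comm, ← hd] at h2
    have h3 := G1.right_le h2 (G1.lt_mid.trans h1)
    exact hno (hx.of_between G1.mid hpmx hpp (hpb1.le.trans h3))
  have hsym := G1.symm_of_orders IH1 hdiv
  -- By symmetry the reflection of p in `p1` falls in the left half of the comparison gap. Since m +
  -- `m1` ≤ `n'`, it is not shift-maximal, and neither is there a point of order below m that a late
  -- first return would produce; a return at time `m1` would make p renormalized.
  obtain ⟨hzd, hzi⟩ := G1.mid.mirror G.mid hm1m (G1.abs_lt ha1p.le hpb1.le).le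
  rcases G1.first_return hzd (by omega) (by linarith) (by linarith)
    (fun hz => by have := IH1 _ _ hz (by linarith) (by linarith); omega) with
    ⟨-, hr⟩ | ⟨i, q, hmi, him, hq, h3, h4, -⟩
  · rw [hzi m1 le_rfl] at hr
    exact hno (G1.img_of_return hpmx hpp hpb1 hr)
  · have := IH1 _ _ hq h3 h4
    omega

theorem symm (G : Gap n a b m p) (hmn : ¬ m ∣ n) : 2 * p - a = b :=
  G.symm_of_orders G.lt_order_add hmn

end Gap

/-! ### The reflection of the left end of a gap -/

namespace Gap

variable {n m : ℕ} {a b p : ℚ}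

theorem two_le_order (G : Gap n a b m p) : 2 ≤ m := by
  by_contra hm
  have := G.mid.pos_order
  obtain rfl : m = 1 := by omega
  have := G.mid.one_eq
  linarith [G.left.half_le, G.lt_mid]

theorem three_quarters_lt (G : Gap n a b m p) : 3 / 4 < a :=
  G.left.three_quarters_lt (by have := G.two_le_order; have := G.order_lt; omega)

/-- Otherwise grafting R…RC to the left of p would give a shift-maximal point of order n between a
and p. The bound is what allows T^m a to be coded by a sequence. -/
theorem half_le_iterate (G : Gap n a b m p) : 1 / 2 ≤ tent^[m] a := by
  by_contra hcon
  have hmn := G.order_lt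
  have hu := dy_alt (n - m - 1)
  rw [show n - m - 1 + 1 = n - m by omega] at hu
  have hmem := alt_mem (n - m - 1)
  have h1 : (1 - alt (n - m - 1)) / 2 ^ m < (1 - tent^[m] a) / 2 ^ m := by gcongr; linarith
  have h2 := G.left_eq
  have h3 : 0 < (1 - alt (n - m - 1)) / 2 ^ m := div_pos (by linarith) (by positivity)
  have h4 := G.fill hu (by linarith) fun i hi => by
    rw [iterate_alt (by omega)]
    linarith [(alt_mem (n - m - 1 - i)).2, G.three_quarters_lt]
  rw [Nat.sub_add_cancel hmn.le] at h4
  exact G.free _ h4 (by linarith) (by linarith [G.mid_lt])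

/-- If the order `m` of the middle point divides `n`, the left end returns above every
shift-maximal point of order `m` to its left. -/
theorem le_iterate_of_dvd (G : Gap n a b m p) (hmn : m ∣ n) {x : ℚ} (hx : Mx m x) (hxa : x < a) :
    x ≤ tent^[m] a := by
  by_contra hcon
  have hpos : (0 : ℚ) < 2 ^ m := by positivity
  have hae := G.left_eq
  -- Starting from x, graft repeatedly onto the left of p: each graft adds m to the order, stays
  -- below p and, if T^m a < x, above a. After d - 1 grafts, with n = dm, the order is n.
  have key : ∀ k, ∃ z, Mx ((k + 1) * m) z ∧ z < p ∧ a < p - (1 - z) / 2 ^ m ∧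
      z < p - (1 - z) / 2 ^ m ∧ (1 ≤ k → a < z) := by
    intro k
    induction k with
    | zero =>
      have h1 : (1 - x) / 2 ^ m < (1 - tent^[m] a) / 2 ^ m := by gcongr; linarith
      exact ⟨x, by rwa [zero_add, one_mul], by linarith [G.lt_mid], by linarith, by linarith,
        fun h => by omega⟩
    | succ k ih =>
      obtain ⟨z, h1, h2, h3, h4, -⟩ := ih
      have h5 := G.fill h1.1 h3.le fun i hi => (h1.iterate_le hi).trans_lt h4
      have h6 : 0 < (1 - z) / 2 ^ m := div_pos (by linarith [h1.1.lt_one]) hpos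
      have h7 : (1 - (p - (1 - z) / 2 ^ m)) / 2 ^ m < (1 - z) / 2 ^ m := by gcongr
      refine ⟨_, ?_, by linarith, by linarith, by linarith, fun _ => h3⟩
      rw [add_mul (k + 1), one_mul]
      exact h5
  obtain ⟨d, rfl⟩ := hmn
  have hm := G.mid.pos_order
  have hd : 2 ≤ d := by
    have := G.order_lt
    by_contra h
    interval_cases d <;> omega
  obtain ⟨z, h1, h2, -, -, h3⟩ := key (d - 1)
  rw [Nat.sub_add_cancel (by omega), mul_comm] at h1
  exact G.free z h1 (h3 (by omega)) (h2.trans G.mid_lt)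

/-- A violation at time i forces T^(m-i) p > x. The gap (x, p) of order m is symmetric, and this
transfers the inequality to T^(m-i) x > x, against the maximality of x. -/
theorem mirror_mx_of_pred (G : Gap n a b m p) (hmn : m ∣ n)
    (hno : ∀ l q k y, Mx l q → 2 ≤ l → q < a → Img q l k y p → False) {x : ℚ} (hx : Mx m x)
    (hxp : x < p) (hxm : ∀ y, Mx m y → y < p → y ≤ x) :
    ∀ i, 1 ≤ i → i < m → tent^[i] (2 * p - a) < 2 * p - a := by
  obtain ⟨m1, p1, G1⟩ := exists_gap hx G.mx_mid hxp
    (fun y hy h1 h2 => absurd (hxm y hy h2) (not_le.2 h1))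
  have hm1 := G1.order_lt
  have hp1a : p1 < a := by
    by_contra h
    have hne : a ≠ p1 := G.left.1.ne_of_order G1.mid (by have := G.order_lt; omega)
    have := (G.order_le G1.mid (lt_of_le_of_ne (not_lt.1 h) hne) (G1.mid_lt.trans G.mid_lt)).1
    omega
  have hm12 := G1.two_le_order
  have hxa : x < a := G1.lt_mid.trans hp1a
  have hdiv : ¬ m1 ∣ m := by
    rintro ⟨d, hd⟩
    have hd2 : 1 < d := by
      rw [hd] at hm1
      exact Nat.one_lt_iff_ne_zero_and_ne_one.2 ⟨by rintro rfl; omega, by rintro rfl; omega⟩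
    have htop := mx_top (show 1 ≤ d by omega)
    obtain ⟨z, hz⟩ := Img.exists_of_dy p1 m1 htop.1
    have h1 : p1 < z := (Img.base.lt_iff_lt hz G1.mid).1 (Dy.base.lt_top hd2)
    have h2 := (hz.mx_iff G1.mx_mid).1 htop
    rw [mul_comm, ← hd] at h2
    obtain ⟨k, y, hk⟩ := hz.of_between G1.mid G.mx_mid G1.mid_lt (G1.right_le h2 (G1.lt_mid.trans h1))
    exact hno _ _ _ _ G1.mx_mid hm12 hp1a hk
  have hsym := G1.symm hdiv
  have hmir := (G1.mid.mirror G.mid hm1 (G1.abs_lt hxp.le le_rfl).le).2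
  rw [show 2 * p1 - p = x by linarith] at hmir
  have hv := G.le_iterate_of_dvd hmn hx hxa
  intro i hi him
  by_contra hcon
  have hlt := G.lt_mid
  have hab := hlt.trans G.mid_lt
  have hda := G.near_left
  have hd2 : |2 * p - a - p| ≤ 1 / 2 ^ m := by
    rw [abs_of_pos (by linarith)]; linarith
  have h1 := G.mid.abs_iterate_sub him hd2
  rw [abs_of_pos (show 0 < 2 * p - a - p by linarith)] at h1
  have h2 := le_abs_self (tent^[i] (2 * p - a) - tent^[i] p)
  have hs := G.mid.iterate him
  have hsp := G.mx_mid.2 i hi him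
  obtain ⟨k, rfl⟩ := Nat.exists_eq_add_of_lt him
  have hkk : i + k + 1 - i = k + 1 := by omega
  rw [hkk] at hs
  have hsep' := G.mid.sep hs (by omega) hsp.ne
  rw [abs_of_neg (by linarith)] at hsep'
  set s := tent^[i] p
  have hpow : (2 : ℚ) ^ i * (1 / 2 ^ (i + k + 1)) = 1 / 2 ^ (k + 1) := by
    rw [add_assoc, pow_add]; field_simp
  -- Up to time i < m the map expands by exactly 2^i near p, so a violation at 2p - a bounds the
  -- distance from p to s = T^i p.
  have hps : p - s ≤ 2 ^ i * (p - a) - (p - a) := by linarith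
  have hps2 : (2 : ℚ) ^ i * (p - a) < 1 / 2 ^ (k + 1) := by
    rw [← hpow]; exact mul_lt_mul_of_pos_left hda (by positivity)
  have hpk := hs.peak (y := p) (by rw [abs_of_pos (by linarith)]; linarith)
  have hak := hs.peak (y := a) (by rw [abs_of_pos (by linarith)]; linarith)
  rw [abs_of_pos (by linarith)] at hpk hak
  have hva := G.mid.peak (y := a) (by rw [abs_of_neg (by linarith)]; linarith)
  rw [abs_of_neg (by linarith)] at hva
  have hkp : x < tent^[k + 1] p := by
    have h3 : (2 : ℚ) ^ (k + 1) * (p - s) < 2 ^ (k + 1) * (2 ^ i * (p - a)) :=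
      mul_lt_mul_of_pos_left (by linarith) (by positivity)
    have h4 : (2 : ℚ) ^ (k + 1) * (2 ^ i * (p - a)) = 2 ^ (i + k + 1) * (p - a) := by
      rw [show i + k + 1 = (k + 1) + i by ring, pow_add (2 : ℚ) (k + 1) i]; ring
    linarith
  have hxk := hx.2 (k + 1) (by omega) (by omega)
  -- Before time `m1` the iterate is affine on [x, p]; it decreases from a to p, hence also from x
  -- to p. From time `m1` on, the mirror points x and p have the same images.
  rcases Nat.lt_or_ge (k + 1) m1 with hk | hk
  · obtain ⟨σ, hσ, H⟩ := G1.mid.affine hk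
    have e1 := H x (G1.abs_lt le_rfl hxp.le).le
    have e2 := H p (G1.abs_lt hxp.le le_rfl).le
    have e3 := H a (G1.abs_lt hxa.le hlt.le).le
    have h5 : (2 : ℚ) ^ (k + 1) * (a - s) < 2 ^ (k + 1) * (p - s) :=
      mul_lt_mul_of_pos_left (by linarith) (by positivity)
    have h6 : (2 : ℚ) ^ (k + 1) * (a - p1) < 2 ^ (k + 1) * (p - p1) :=
      mul_lt_mul_of_pos_left (by linarith) (by positivity)
    have h7 : (2 : ℚ) ^ (k + 1) * (x - p1) < 2 ^ (k + 1) * (p - p1) :=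
      mul_lt_mul_of_pos_left (by linarith) (by positivity)
    rcases hσ with rfl | rfl
    · linarith
    · linarith
  · have := hmir (k + 1) hk
    linarith

/-- Here p must be `zig (m - 3)`, whose images are explicit, and a ≥ `zig (n - 3)` makes p - a small
enough for a direct estimate. -/
theorem mirror_mx_of_no_pred (G : Gap n a b m p) (hmn : m ∣ n) (hp : 5 / 6 < p)
    (hno : ¬ ∃ x, Mx m x ∧ x < p) :
    ∀ i, 1 ≤ i → i < m → tent^[i] (2 * p - a) < 2 * p - a := by
  have hm3 : 3 ≤ m := by
    by_contra h
    have := G.mid.le_top (show m ≤ 2 by omega)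
    norm_num at this
    linarith
  obtain ⟨e, rfl⟩ := Nat.exists_eq_add_of_le' hm3
  have hpz : p = zig e := by
    refine le_antisymm ?_ (zig_le G.mid le_rfl hp)
    by_contra h
    exact hno ⟨_, mx_zig e, not_le.1 h⟩
  have hn2 : 2 * (e + 3) ≤ n := by
    obtain ⟨d, rfl⟩ := hmn
    have := G.order_lt
    have : 2 ≤ d := by
      by_contra h
      interval_cases d <;> omega
    rw [mul_comm]
    exact Nat.mul_le_mul_left _ this
  have hza : zig (n - 3) ≤ a := by
    by_contra h
    have h1 := mx_zig (n - 3)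
    rw [Nat.sub_add_cancel (by omega)] at h1
    have h2 := zig_le (q := n - 3) G.mid (by omega) hp
    exact G.free _ h1 (not_le.1 h) (h2.trans_lt G.mid_lt)
  have hmid := G.mid_lt
  have hlt := G.lt_mid
  -- Since n ≥ 2(e + 3), the term (-1/2)^(n-3) of `zig (n - 3)` is at most 1/8 · 2⁻ᵉ · 2⁻ᵉ in
  -- absolute value, and 1/192 = 1/24 · 1/8.
  have hd : p - a ≤ 1 / 24 * (1 / 2 ^ e) + 1 / 192 * (1 / 2 ^ e) * (1 / 2 ^ e) := by
    have h1 := zig_eq (n - 3)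
    have h2 := neg_abs_le ((-1 / 2 : ℚ) ^ (n - 3))
    rw [abs_neg_half_pow] at h2
    have h3 := zig_eq e
    have h4 := le_abs_self ((-1 / 2 : ℚ) ^ e)
    rw [abs_neg_half_pow] at h4
    have h5 := inv_pow_le (show e + e + 3 ≤ n - 3 by omega)
    rw [pow_add, pow_add] at h5
    have h6 : (1 : ℚ) / (2 ^ e * 2 ^ e * 2 ^ 3) = 1 / 8 * (1 / 2 ^ e) * (1 / 2 ^ e) := by
      field_simp; norm_num
    linarith
  have hpe : p = 5 / 6 + 1 / 24 * (1 / 2 ^ e) := by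
    have h3 := zig_eq e
    rcases abs_choice ((-1 / 2 : ℚ) ^ e) with h | h
    · rw [abs_neg_half_pow] at h
      rw [hpz, h3, h]
    · rw [abs_neg_half_pow] at h
      linarith [inv_pow_pos e]
  intro i hi him
  have h1 := G.mid.abs_iterate_sub him (y := 2 * p - a)
    (by rw [abs_of_pos (by linarith)]; linarith [G.near_left])
  rw [abs_of_pos (show 0 < 2 * p - a - p by linarith)] at h1
  have h2 := le_abs_self (tent^[i] (2 * p - a) - tent^[i] p)
  have he1 : (1 : ℚ) / 2 ^ e ≤ 1 := by simpa using inv_pow_le (Nat.zero_le e)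
  rcases i with _ | _ | j
  · omega
  · have h3 : tent^[0 + 1] p = alt e / 2 := by
      have := alt_mem e
      change tent p = _
      rw [hpz, zig_eq', tent_one_sub (by linarith)]
    have := (alt_mem e).2
    rw [h3] at h1 h2
    have h4 : 1 / 192 * (1 / 2 ^ e) * (1 / 2 ^ e) ≤ 1 / 192 * 1 * (1 : ℚ) := by gcongr
    rw [zero_add, pow_one] at h1
    rw [zero_add] at *
    linarith
  · have hje : j ≤ e := by omega
    have h3 : tent^[j + 1 + 1] p = alt (e - j) := by
      rw [hpz]
      exact (iterate_zig e j).trans (iterate_alt hje)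
    rw [h3] at h1 h2
    have h4 : (2 : ℚ) ^ (j + 1 + 1) * (1 / 2 ^ e) = 4 * (1 / 2 ^ (e - j)) := by
      obtain ⟨r, rfl⟩ := Nat.exists_eq_add_of_le hje
      rw [Nat.add_sub_cancel_left, pow_add]; field_simp; ring
    have h5 : (2 : ℚ) ^ (j + 1 + 1) * (2 * p - a - p) ≤
        2 ^ (j + 1 + 1) * (1 / 24 * (1 / 2 ^ e) + 1 / 192 * (1 / 2 ^ e) * (1 / 2 ^ e)) :=
      mul_le_mul_of_nonneg_left (by linarith) (by positivity)
    have h6 : (2 : ℚ) ^ (j + 1 + 1) *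
        (1 / 24 * (1 / 2 ^ e) + 1 / 192 * (1 / 2 ^ e) * (1 / 2 ^ e)) =
          1 / 6 * (1 / 2 ^ (e - j)) + 1 / 48 * (1 / 2 ^ (e - j)) * (1 / 2 ^ e) := by
      linear_combination (1 / 24 + 1 / 192 * (1 / 2 ^ e)) * h4
    have he0 := inv_pow_pos e
    -- For j = e the image of p is 1/2 itself; otherwise 2^-(e-j) ≤ 1/2 is available.
    rcases Nat.eq_zero_or_pos (e - j) with h7 | h7
    · rw [h7, alt_zero] at h1 h2
      rw [h7] at h6
      rw [pow_zero, div_one, mul_one, mul_one] at h6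
      linarith
    · have h8 := inv_pow_le h7
      rw [pow_one] at h8
      have h9 : alt (e - j) ≤ 2 / 3 + 1 / 6 * (1 / 2 ^ (e - j)) := by
        have := neg_abs_le ((-1 / 2 : ℚ) ^ (e - j))
        rw [abs_neg_half_pow] at this
        unfold alt
        linarith
      have h10 : 1 / 48 * (1 / 2 ^ (e - j)) * (1 / 2 ^ e) ≤ 1 / 48 * (1 / 2) * (1 / 2 ^ e : ℚ) := by
        gcongr
      linarith

/-- The mirror image of the left end of a gap in its middle point is shift-maximal. -/
theorem mirror_mx (G : Gap n a b m p) : Mx n (2 * p - a) := by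
  induction n using Nat.strong_induction_on generalizing m a b p with
  | _ n IH =>
  by_cases hmn : m ∣ n
  swap
  · rw [G.symm hmn]; exact G.right
  by_cases hR : ∃ l q k y, Mx l q ∧ 2 ≤ l ∧ q < a ∧ Img q l k y p
  · obtain ⟨l, q, k, y, hq, hl, hqa, hp⟩ := hR
    obtain ⟨n', a', b', ha', G', rfl, rfl⟩ := G.renorm hq hqa hp
    have hn' := G'.left.1.pos_order
    have h1 := IH n' (by nlinarith) G'
    -- The reflection is a graft of T^m a, and grafting commutes with renormalization.
    have h2 := (hp.graft (ha'.iterate hq.1 G'.order_lt)).2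
    rw [Nat.sub_add_cancel G'.order_lt.le, show y + (1 - tent^[k] a') / 2 ^ k = 2 * y - a' by
      linarith [G'.left_eq], show p + (1 - tent^[k * l] a) / 2 ^ (k * l) = 2 * p - a by
      linarith [G.left_eq]] at h2
    exact (h2.mx_iff hq).1 h1
  have hno : ∀ l q k y, Mx l q → 2 ≤ l → q < a → Img q l k y p → False :=
    fun l q k y h1 h2 h3 h4 => hR ⟨l, q, k, y, h1, h2, h3, h4⟩
  have hp : 5 / 6 < p := by
    by_contra h
    obtain ⟨k, y, hk⟩ := G.mx_mid.img_three_quarters G.two_le_order (not_lt.1 h)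
    exact hno _ _ _ _ mx_three_quarters le_rfl G.three_quarters_lt hk
  obtain ⟨hd, hi⟩ := G.mid.mirror G.left.1 G.order_lt
    (G.abs_lt le_rfl (G.lt_mid.trans G.mid_lt).le).le
  refine ⟨hd, fun i h1 h2 => ?_⟩
  rcases Nat.lt_or_ge i m with him | him
  · by_cases hpred : ∃ x, Mx m x ∧ x < p
    · obtain ⟨x, hx, hxp, hxm⟩ := exists_mx_pred hpred
      exact G.mirror_mx_of_pred hmn hno hx hxp hxm i h1 him
    · exact G.mirror_mx_of_no_pred hmn hp hpred i h1 him
  · rw [hi i him]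
    linarith [G.left.2 i h1 h2, G.lt_mid]

/-- Shift-maximal points inside a gap whose order divides `n` are renormalized. -/
theorem img_of_dvd (G : Gap n a b m p) {c : ℕ} {q : ℚ} (hq : Mx c q) (hcn : c ∣ n) (h1 : a < q)
    (h2 : q < b) : ∃ k y, Img p m k y q := by
  have hn : 0 < n := G.left.1.pos_order
  have hlt : c < n := by
    rcases Nat.eq_or_lt_of_le (Nat.le_of_dvd hn hcn) with h | h
    · exact (G.free q (h ▸ hq) h1 h2).elim
    · exact h
  have h2c : 2 * c ≤ n := by
    obtain ⟨d, rfl⟩ := hcn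
    have : 2 ≤ d := by
      by_contra h
      interval_cases d <;> omega
    rw [mul_comm]
    exact Nat.mul_le_mul_left _ this
  have hmc := G.order_le hq.1 h1 h2
  -- In the left half `lt_order_add` would give n < c + m ≤ 2c ≤ n.
  rcases lt_trichotomy q p with h | h | h
  · have := G.lt_order_add c q hq h1 h
    omega
  · subst h
    exact ⟨_, _, .base⟩
  have hmc' : m < c := by
    rcases Nat.eq_or_lt_of_le hmc.1 with h3 | h3
    · exact absurd (hmc.2 h3.symm) h.ne'
    · exact h3
  by_cases hmn : m ∣ n
  · obtain ⟨d, rfl⟩ := hmn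
    have hd : 1 < d := by
      have := G.order_lt
      by_contra h
      interval_cases d <;> omega
    have htop := mx_top (show 1 ≤ d by omega)
    obtain ⟨z, hz⟩ := Img.exists_of_dy p m htop.1
    have h3 : p < z := (Img.base.lt_iff_lt hz G.mid).1 (Dy.base.lt_top hd)
    have h4 := (hz.mx_iff G.mx_mid).1 htop
    rw [mul_comm] at h4
    exact hz.of_between G.mid hq h (h2.le.trans (G.right_le h4 (G.lt_mid.trans h3)))
  · have hsym := G.symm hmn
    -- In a symmetric gap the reflection of q lies in the left half. Its order c, and that of the
    -- point given by a late first return, are too small there, so it returns at time m and q is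
    -- renormalized.
    obtain ⟨hzd, hzi⟩ := G.mid.mirror hq.1 hmc' (G.abs_lt h1.le h2.le).le
    rcases G.first_return hzd hlt.le (by linarith) (by linarith)
      (fun hz => by have := G.lt_order_add _ _ hz (by linarith) (by linarith); omega) with
      ⟨-, hr⟩ | ⟨j, x, hmj, hjc, hx, h3, h4, -⟩
    · rw [hzi m le_rfl] at hr
      exact G.img_of_return hq h h2 hr
    · have := G.lt_order_add _ _ hx h3 h4
      omega

end Gap

/-! ### Harmonics and least points -/

/-- The harmonics of `1/2`. -/
def harm : ℕ → ℚ
  | 0 => 1 / 2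
  | j + 1 => harm j + (1 - harm j) / 2 ^ 2 ^ j

/-- The cascade of period doublings: renormalization at 3/4 moves each harmonic of 1/2 to the next,
because it commutes with grafting. -/
theorem harm_img (j : ℕ) : Img (3 / 4) 2 (2 ^ j) (harm j) (harm (j + 1)) := by
  induction j with
  | zero =>
    have : harm (0 + 1) = 3 / 4 := by norm_num [harm]
    rw [this]
    exact .base
  | succ j ih =>
    have h := (ih.graft ih).2
    rw [← two_mul, ← pow_succ', ← pow_succ] at h
    exact h

theorem mx_harm (j : ℕ) : Mx (2 ^ j) (harm j) := by
  induction j with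
  | zero => exact ⟨.base, fun i h1 h2 => by omega⟩
  | succ j ih => rw [pow_succ]; exact ((harm_img j).mx_iff mx_three_quarters).1 ih

theorem harm_strictMono : StrictMono harm := by
  refine strictMono_nat_of_lt_succ fun j => ?_
  have : 0 < (1 - harm j) / 2 ^ 2 ^ j :=
    div_pos (by linarith [(mx_harm j).1.lt_one]) (by positivity)
  rw [harm]
  linarith

/-- `x` is the least shift-maximal point of order `n`. -/
def IsLeastMx (n : ℕ) (x : ℚ) : Prop := Mx n x ∧ ∀ y, Mx n y → x ≤ y

theorem isLeastMx_one : IsLeastMx 1 (1 / 2) :=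
  ⟨⟨.base, fun i h1 h2 => by omega⟩, fun _ h => h.half_le⟩

theorem zig_le_of_odd {c q : ℕ} {x : ℚ} (hx : Mx c x) (h2 : 2 ≤ c) (hcq : c ≤ q + 3)
    (hc : ¬ 2 ∣ c) : zig q ≤ x := by
  refine zig_le hx.1 hcq ?_
  by_contra h
  obtain ⟨k, y, hk⟩ := hx.img_three_quarters h2 (not_lt.1 h)
  exact hc ⟨k, by rw [hk.order_eq dy_three_quarters hx.1, mul_comm]⟩

theorem isLeastMx_zig {q : ℕ} (hq : Even q) : IsLeastMx (q + 3) (zig q) :=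
  ⟨mx_zig q, fun y hy => zig_le_of_odd hy (by omega) le_rfl (by
    obtain ⟨r, rfl⟩ := hq
    omega)⟩

/-- By `Img.return_le` the renormalized point is at most 5/6, and every shift-maximal point of the
same order up to 5/6 is renormalized as well; monotonicity of the renormalization concludes. -/
theorem IsLeastMx.double {n : ℕ} {y x : ℚ} (h : IsLeastMx n y) (hx : Img (3 / 4) 2 n y x) :
    IsLeastMx (n * 2) x ∧ x ≤ 5 / 6 := by
  have h56 : x ≤ 5 / 6 := by
    rcases le_or_gt x (3 / 4) with h1 | h1
    · linarith
    · have := hx.return_le dy_three_quarters h1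
      linarith
  refine ⟨⟨(hx.mx_iff mx_three_quarters).1 h.1, fun z hz => ?_⟩, h56⟩
  rcases le_or_gt z (5 / 6) with h1 | h1
  · obtain ⟨k, w, hw⟩ := hz.img_three_quarters (by have := h.1.1.pos_order; omega) h1
    have := hw.order_eq dy_three_quarters hz.1
    obtain rfl : n = k := by omega
    exact (hx.le_iff_le hw dy_three_quarters).1 (h.2 w ((hw.mx_iff mx_three_quarters).2 hz))
  · linarith

theorem IsLeastMx.unique {n : ℕ} {x y : ℚ} (hx : IsLeastMx n x) (hy : IsLeastMx n y) : x = y :=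
  le_antisymm (hx.2 _ hy.1) (hy.2 _ hx.1)

theorem exists_isLeastMx {n : ℕ} (hn : 1 ≤ n) : ∃ x, IsLeastMx n x := by
  have hf : {x | Mx n x}.Finite := (Dy.finite n).subset fun x hx => hx.1
  obtain ⟨x, hx, H⟩ := Set.exists_min_image _ id hf ⟨_, mx_top hn⟩
  exact ⟨x, hx, H⟩

/-- Halving: the least point of order `2 n` is renormalized from that of order `n`. -/
theorem IsLeastMx.exists_half {n : ℕ} {x : ℚ} (h : IsLeastMx (n * 2) x) (hn : 1 ≤ n) :
    ∃ y, IsLeastMx n y ∧ Img (3 / 4) 2 n y x ∧ x ≤ 5 / 6 := by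
  obtain ⟨y, hy⟩ := exists_isLeastMx hn
  obtain ⟨z, hz⟩ := Img.exists_of_dy (3 / 4) 2 hy.1.1
  obtain rfl := (hy.double hz).1.unique h
  exact ⟨y, hy, hz, (hy.double hz).2⟩

/-- The points of order dividing `n` up to the least point of order `n`. -/
theorem IsLeastMx.eq_or_eq_harm {n : ℕ} {l : ℚ} (h : IsLeastMx n l) {c : ℕ} {x : ℚ}
    (hx : Mx c x) (hcn : c ∣ n) (hxl : x ≤ l) : x = l ∨ ∃ j, 2 ^ j ∣ n ∧ x = harm j := by
  induction n using Nat.strong_induction_on generalizing l c x with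
  | _ n IH =>
  have hn : 1 ≤ n := h.1.1.pos_order
  have hc := hx.1.pos_order
  rcases Nat.eq_or_lt_of_le hc with hc1 | hc2
  · subst hc1
    exact .inr ⟨0, one_dvd _, hx.1.one_eq⟩
  have hle := Nat.le_of_dvd hn hcn
  by_cases hev : 2 ∣ n
  · obtain ⟨n', rfl⟩ := hev
    rw [mul_comm] at h hcn
    obtain ⟨y, hy, hyl, h56⟩ := h.exists_half (by omega)
    obtain ⟨k, w, hw⟩ := hx.img_three_quarters hc2 (hxl.trans h56)
    have hck := hw.order_eq dy_three_quarters hx.1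
    subst hck
    rcases IH n' (by omega) hy ((hw.mx_iff mx_three_quarters).2 hx)
      (Nat.dvd_of_mul_dvd_mul_right (by norm_num) hcn)
      ((hw.le_iff_le hyl dy_three_quarters).2 hxl) with h1 | ⟨j, h1, h2⟩
    · subst h1
      exact .inl (hw.unique hyl)
    · subst h2
      exact .inr ⟨j + 1, by rw [pow_succ']; exact Nat.mul_dvd_mul_left 2 h1,
        hw.unique (harm_img j)⟩
  · left
    have hc' : ¬ 2 ∣ c := fun h2 => hev (h2.trans hcn)
    obtain ⟨q, rfl⟩ := Nat.exists_eq_add_of_le' (show 3 ≤ n by omega)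
    have hq : Even q := by
      rw [Nat.even_iff]; omega
    obtain rfl := h.unique (isLeastMx_zig hq)
    exact le_antisymm hxl (zig_le_of_odd hx hc2 hle hc')

theorem IsLeastMx.harm_le {n : ℕ} {l : ℚ} (h : IsLeastMx n l) {j : ℕ} (hj : 2 ^ j ∣ n) :
    harm j ≤ l := by
  induction j generalizing n l with
  | zero => exact h.1.half_le
  | succ j ih =>
    rw [pow_succ'] at hj
    obtain ⟨n', rfl⟩ : 2 ∣ n := (dvd_mul_right _ _).trans hj
    rw [mul_comm] at h
    have := h.1.1.pos_order
    obtain ⟨y, hy, hyl, -⟩ := h.exists_half (by omega)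
    exact ((harm_img j).le_iff_le hyl dy_three_quarters).1
      (ih hy (Nat.dvd_of_mul_dvd_mul_left (by norm_num) hj))

/-! ### The right end and the interior of a gap -/

namespace Gap

variable {n m : ℕ} {a b p : ℚ}

/-- If the order of the middle point divides `n`, the right end is renormalized from the least
point of order `n / m`. -/
theorem right_img (G : Gap n a b m p) {d : ℕ} (hd : n = d * m) {l : ℚ} (hl : IsLeastMx d l) :
    Img p m d l b := by
  have hm := G.mid.pos_order
  have hd1 : 1 < d := by
    have := G.order_lt
    by_contra h
    interval_cases d <;> omega
  -- Shift-maximal points of order d ≥ 2 exceed 2/3 > 1/2, so their images lie to the right of p and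
  -- hence not before b.
  have key : ∀ z, Mx d z → ∃ w, Img p m d z w ∧ p < w ∧ b ≤ w := by
    intro z hz
    obtain ⟨w, hw⟩ := Img.exists_of_dy p m hz.1
    have h1 : p < w := (Img.base.lt_iff_lt hw G.mid).1 (by linarith [hz.two_thirds_lt hd1])
    exact ⟨w, hw, h1, G.right_le (hd ▸ (hw.mx_iff G.mx_mid).1 hz) (G.lt_mid.trans h1)⟩
  obtain ⟨w, hw, h1, h2⟩ := key l hl.1
  obtain ⟨k, y, hk⟩ := hw.of_between G.mid G.right G.mid_lt h2
  have hkd := hk.order_eq G.mid G.right.1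
  obtain rfl : d = k := Nat.eq_of_mul_eq_mul_right hm (hd.symm.trans hkd)
  have h3 := hl.2 y ((hk.mx_iff G.mx_mid).2 (hkd ▸ G.right))
  have h4 := (hw.le_iff_le hk G.mid).1 h3
  rwa [le_antisymm h2 h4]

/-- The points of order dividing `n` in a gap are the harmonics of its middle point. -/
theorem exists_harm_img (G : Gap n a b m p) {d : ℕ} (hd : n = d * m) {c : ℕ} {q : ℚ} (hq : Mx c q)
    (hcn : c ∣ n) (h1 : a < q) (h2 : q < b) : ∃ j, 2 ^ j ∣ d ∧ Img p m (2 ^ j) (harm j) q := by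
  have hm := G.mid.pos_order
  obtain ⟨l, hl⟩ := exists_isLeastMx (show 1 ≤ d by
    have := G.order_lt
    by_contra h
    interval_cases d; omega)
  obtain ⟨k, y, hk⟩ := G.img_of_dvd hq hcn h1 h2
  have hb := G.right_img hd hl
  have hck := hk.order_eq G.mid hq.1
  subst hck hd
  have hyl := (hk.lt_iff_lt hb G.mid).2 h2
  rcases hl.eq_or_eq_harm ((hk.mx_iff G.mx_mid).2 hq) (Nat.dvd_of_mul_dvd_mul_right hm hcn)
    hyl.le with h | ⟨j, hj, rfl⟩
  · exact absurd h hyl.ne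
  · obtain rfl := hk.dy_source.order_unique (mx_harm j).1
    exact ⟨j, hj, hk⟩

theorem dvd_of_mem (G : Gap n a b m p) {c : ℕ} {q : ℚ} (hq : Mx c q)
    (hcn : c ∣ n) (h1 : a < q) (h2 : q < b) : m ∣ n := by
  obtain ⟨k, y, hk⟩ := G.img_of_dvd hq hcn h1 h2
  have hck := hk.order_eq G.mid hq.1
  subst hck
  exact (dvd_mul_left _ _).trans hcn

end Gap

/-! ### Sequences as points -/

/-- All entries are positive. -/
def Pos (α : Sequence) : Prop := ∀ x ∈ α, 0 < x

theorem Pos.nil : Pos [] := fun _ h => absurd h (List.not_mem_nil)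

theorem pos_cons {a : ℕ} {α : Sequence} : Pos (a :: α) ↔ 0 < a ∧ Pos α := List.forall_mem_cons

theorem pos_append {α β : Sequence} : Pos (α ++ β) ↔ Pos α ∧ Pos β := List.forall_mem_append

theorem Pos.drop {α : Sequence} (h : Pos α) (i : ℕ) : Pos (α.drop i) :=
  fun x hx => h x (List.mem_of_mem_drop hx)

theorem Pos.take {α : Sequence} (h : Pos α) (i : ℕ) : Pos (α.take i) :=
  fun x hx => h x (List.mem_of_mem_take hx)

/-- The point whose itinerary is coded by a sequence. -/
def val : Sequence → ℚ
  | [] => 1 / 2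
  | a :: α => 1 - val α / 2 ^ a

theorem degree_nil : degree [] = 0 := rfl

theorem degree_cons (a : ℕ) (α : Sequence) : degree (a :: α) = a + degree α := List.sum_cons

theorem degree_append (α β : Sequence) : degree (α ++ β) = degree α + degree β := List.sum_append

theorem Dy.div_pow {k : ℕ} {y : ℚ} (h : Dy k y) (j : ℕ) : Dy (k + j) (y / 2 ^ j) := by
  induction j with
  | zero => simpa using h
  | succ j ih =>
    rw [pow_succ, ← div_div]
    exact ih.left

theorem dy_val {α : Sequence} (h : Pos α) : Dy (1 + degree α) (val α) := by
  induction α with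
  | nil => exact .base
  | cons a α ih =>
    rw [pos_cons] at h
    obtain ⟨a, rfl⟩ := Nat.exists_eq_add_of_le' h.1
    have := ((ih h.2).div_pow a).right
    rw [div_div, ← pow_succ] at this
    rw [degree_cons, val]
    convert this using 1
    omega

theorem val_lt_one {α : Sequence} (h : Pos α) : val α < 1 := (dy_val h).lt_one

theorem div_two_pow_lt {a : ℕ} (ha : 0 < a) {v : ℚ} (h1 : v < 1) :
    v / 2 ^ a < 1 / 2 := by
  have h := inv_pow_le ha
  have : v / 2 ^ a < 1 / 2 ^ a := by gcongr
  linarith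

theorem half_lt_val {a : ℕ} {α : Sequence} (h : Pos (a :: α)) : 1 / 2 < val (a :: α) := by
  rw [pos_cons] at h
  have := div_two_pow_lt h.1 (val_lt_one h.2)
  rw [val]
  linarith

theorem half_le_val {α : Sequence} (h : Pos α) : 1 / 2 ≤ val α := by
  cases α with
  | nil => exact le_rfl
  | cons a α => exact (half_lt_val h).le

theorem val_cons_lt {a b : ℕ} {α β : Sequence} (hα : Pos α) (hβ : Pos β) (h : a < b) :
    val (a :: α) < val (b :: β) := by
  have h1 : val β / 2 ^ b < 1 / 2 ^ b := by gcongr; exact val_lt_one hβ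
  have h2 := inv_pow_le (show a + 1 ≤ b from h)
  rw [inv_pow_succ] at h2
  have h3 : 1 / 2 / 2 ^ a ≤ val α / 2 ^ a := by gcongr; exact half_le_val hα
  have h4 : (1 : ℚ) / 2 / 2 ^ a = 1 / 2 ^ a / 2 := by ring
  rw [val, val]
  linarith

theorem val_injective {α β : Sequence} (hα : Pos α) (hβ : Pos β) (h : val α = val β) : α = β := by
  induction α generalizing β with
  | nil =>
    cases β with
    | nil => rfl
    | cons b β => exact absurd h (half_lt_val hβ).ne
  | cons a α ih =>
    cases β with
    | nil => exact absurd h (half_lt_val hα).ne'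
    | cons b β =>
      rw [pos_cons] at hα hβ
      rcases lt_trichotomy a b with h1 | h1 | h1
      · exact absurd h (val_cons_lt hα.2 hβ.2 h1).ne
      · subst h1
        rw [val, val, sub_right_inj, div_left_inj' (by positivity)] at h
        rw [ih hα.2 hβ.2 h]
      · exact absurd h (val_cons_lt hβ.2 hα.2 h1).ne'

theorem exists_val_eq {n : ℕ} {x : ℚ} (h : Dy n x) (hx : 1 / 2 ≤ x) :
    ∃ α, Pos α ∧ val α = x ∧ 1 + degree α = n := by
  have key : ∃ α j, Pos α ∧ x = val α / 2 ^ j := by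
    clear hx
    induction h with
    | base => exact ⟨[], 0, Pos.nil, by simp [val]⟩
    | left _ ih =>
      obtain ⟨α, j, h1, rfl⟩ := ih
      exact ⟨α, j + 1, h1, by rw [pow_succ, div_div]⟩
    | right _ ih =>
      obtain ⟨α, j, h1, rfl⟩ := ih
      exact ⟨(j + 1) :: α, 0, pos_cons.2 ⟨by omega, h1⟩, by
        rw [val, pow_succ, div_div, pow_zero, div_one]⟩
  obtain ⟨α, j, h1, h2⟩ := key
  -- An itinerary with leading L's would put the point below 1/2.
  have hj : j = 0 := by
    by_contra hj
    have := div_two_pow_lt (Nat.pos_of_ne_zero hj) (val_lt_one h1)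
    linarith
  subst hj
  rw [pow_zero, div_one] at h2
  subst h2
  exact ⟨α, h1, rfl, (dy_val h1).order_unique h⟩

/-! ### The order -/

theorem Al_cons_zero (a : ℕ) (α : Sequence) : Al (a :: α) 0 = a := by simp [Al]

theorem Al_cons_succ (a : ℕ) (α : Sequence) (i : ℕ) : Al (a :: α) (i + 1) = -Al α i := by
  simp [Al, pow_succ]

theorem lt_cons_cons {a b : ℕ} {α β : Sequence} :
    Lt (a :: α) (b :: β) ↔ a < b ∨ (a = b ∧ Lt β α) := by
  constructor
  · rintro ⟨i, h1, h2⟩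
    rcases i with _ | i
    · rw [Al_cons_zero, Al_cons_zero] at h2
      exact .inl (by exact_mod_cast h2)
    · have h0 := h1 0 (by omega)
      rw [Al_cons_zero, Al_cons_zero] at h0
      refine .inr ⟨by exact_mod_cast h0, i, fun j hj => ?_, ?_⟩
      · have := h1 (j + 1) (by omega)
        rw [Al_cons_succ, Al_cons_succ] at this
        linarith
      · rw [Al_cons_succ, Al_cons_succ] at h2
        linarith
  · rintro (h | ⟨rfl, i, h1, h2⟩)
    · exact ⟨0, fun j hj => by omega, by rw [Al_cons_zero, Al_cons_zero]; exact_mod_cast h⟩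
    · refine ⟨i + 1, fun j hj => ?_, by rw [Al_cons_succ, Al_cons_succ]; linarith⟩
      rcases j with _ | j
      · rfl
      · rw [Al_cons_succ, Al_cons_succ, h1 j (by omega)]

theorem Al_nil (i : ℕ) : Al [] i = 0 := by simp [Al]

theorem lt_nil_cons {b : ℕ} {β : Sequence} (hb : 0 < b) : Lt [] (b :: β) :=
  ⟨0, fun j hj => by omega, by rw [Al_cons_zero, Al_nil]; exact_mod_cast hb⟩

theorem Lt.asymm {α β : Sequence} (h : Lt α β) : ¬ Lt β α := by
  obtain ⟨i, h1, h2⟩ := h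
  rintro ⟨j, h3, h4⟩
  rcases lt_trichotomy i j with h5 | h5 | h5
  · have := h3 i h5; linarith
  · subst h5; linarith
  · have := h1 j h5; linarith

theorem lt_of_val_lt_aux {α β : Sequence} (hα : Pos α) (hβ : Pos β) :
    (val α < val β → Lt α β) ∧ (val β < val α → Lt β α) := by
  induction α generalizing β with
  | nil =>
    cases β with
    | nil => exact ⟨fun h => absurd h (lt_irrefl _), fun h => absurd h (lt_irrefl _)⟩
    | cons b β =>
      exact ⟨fun _ => lt_nil_cons (pos_cons.1 hβ).1, fun h => absurd h (half_lt_val hβ).not_gt⟩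
  | cons a α ih =>
    cases β with
    | nil =>
      exact ⟨fun h => absurd h (half_lt_val hα).not_gt, fun _ => lt_nil_cons (pos_cons.1 hα).1⟩
    | cons b β =>
      rw [pos_cons] at hα hβ
      rw [lt_cons_cons, lt_cons_cons]
      rcases lt_trichotomy a b with h1 | rfl | h1
      · exact ⟨fun _ => .inl h1, fun h => absurd h (val_cons_lt hα.2 hβ.2 h1).not_gt⟩
      · have hp : (0 : ℚ) < 2 ^ a := by positivity
        rw [val, val, sub_lt_sub_iff_left, div_lt_div_iff_of_pos_right hp, sub_lt_sub_iff_left,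
          div_lt_div_iff_of_pos_right hp]
        exact ⟨fun h => .inr ⟨rfl, (ih hα.2 hβ.2).2 h⟩, fun h => .inr ⟨rfl, (ih hα.2 hβ.2).1 h⟩⟩
      · exact ⟨fun h => absurd h (val_cons_lt hβ.2 hα.2 h1).not_gt, fun _ => .inl h1⟩

theorem lt_iff_val {α β : Sequence} (hα : Pos α) (hβ : Pos β) : Lt α β ↔ val α < val β := by
  refine ⟨fun h => ?_, (lt_of_val_lt_aux hα hβ).1⟩
  rcases lt_trichotomy (val α) (val β) with h1 | h1 | h1
  · exact h1
  · obtain rfl := val_injective hα hβ h1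
    exact absurd h h.asymm
  · exact absurd ((lt_of_val_lt_aux hα hβ).2 h1) h.asymm

/-! ### Lexical sequences -/

theorem iterate_val_cons {a i : ℕ} {α : Sequence} (h : Pos (a :: α)) (h1 : 1 ≤ i) (h2 : i ≤ a) :
    tent^[i] (val (a :: α)) = val α / 2 ^ (a - i) := by
  rw [pos_cons] at h
  have hv : ∀ j, val α / 2 ^ j ≤ 1 := fun j =>
    (div_le_self (dy_val h.2).pos.le (one_le_pow₀ (by norm_num))).trans (val_lt_one h.2).le
  obtain ⟨i, rfl⟩ := Nat.exists_eq_add_of_le' h1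
  induction i with
  | zero =>
    obtain ⟨a, rfl⟩ := Nat.exists_eq_add_of_le' h.1
    change tent _ = _
    rw [val, pow_succ, ← div_div, tent_one_sub (hv a)]
    simp
  | succ i ih =>
    rw [Function.iterate_succ_apply', ih (by omega) (by omega),
      show a - (i + 1) = (a - (i + 1 + 1)) + 1 by omega, pow_succ, ← div_div, tent_half (hv _)]

theorem iterate_val_degree {α β : Sequence} (h : Pos (α ++ β)) :
    tent^[degree α] (val (α ++ β)) = val β := by
  induction α with
  | nil => rfl
  | cons a α ih =>
    rw [List.cons_append] at h ⊢
    have h1 := iterate_val_cons h (pos_cons.1 h).1 le_rfl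
    rw [Nat.sub_self, pow_zero, div_one] at h1
    rw [degree_cons, add_comm, iterate_add_tent, h1, ih (pos_cons.1 h).2]

/-- An image begins with L, and is then below 1/2, or begins a block, and then codes a right
sequence. Only right sequences therefore compete with α. -/
theorem iterate_val_cases {α : Sequence} (h : Pos α) {i : ℕ} (h1 : 1 ≤ i) (h2 : i ≤ degree α) :
    tent^[i] (val α) < 1 / 2 ∨ ∃ j, 1 ≤ j ∧ j ≤ α.length ∧ tent^[i] (val α) = val (α.drop j) := by
  induction α generalizing i with
  | nil => rw [degree_nil] at h2; omega
  | cons a α ih =>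
    have hp := pos_cons.1 h
    rcases lt_trichotomy i a with h3 | h3 | h3
    · left
      rw [iterate_val_cons h h1 h3.le]
      exact div_two_pow_lt (by omega) (val_lt_one hp.2)
    · right
      refine ⟨1, le_rfl, by simp, ?_⟩
      rw [iterate_val_cons h h1 h3.le, h3, Nat.sub_self, pow_zero, div_one]
      rfl
    · have h4 := iterate_val_cons h hp.1 le_rfl
      rw [Nat.sub_self, pow_zero, div_one] at h4
      rw [degree_cons] at h2
      have h5 : tent^[i] (val (a :: α)) = tent^[i - a] (val α) := by
        rw [← h4, ← iterate_add_tent, Nat.sub_add_cancel h3.le]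
      rw [h5]
      rcases ih hp.2 (by omega) (show i - a ≤ degree α by omega) with h6 | ⟨j, h6, h7, h8⟩
      · exact .inl h6
      · exact .inr ⟨j + 1, by omega, by rw [List.length_cons]; omega, h8⟩

theorem mem_L_iff {n : ℕ} {α : Sequence} : α ∈ L n ↔ Pos α ∧ Mx n (val α) := by
  constructor
  · rintro ⟨h1, h2, rfl⟩
    refine ⟨h1, dy_val h1, fun i hi hin => ?_⟩
    have hne : 1 / 2 < val α := by
      cases α with
      | nil => rw [degree_nil] at hin; omega
      | cons a α => exact half_lt_val h1
    rcases iterate_val_cases h1 hi (by omega) with h3 | ⟨j, h3, h4, h5⟩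
    · linarith
    · rw [h5]
      rcases Nat.eq_or_lt_of_le h4 with h6 | h6
      · rw [h6, List.drop_length]
        exact hne
      · exact (lt_iff_val (Pos.drop h1 j) h1).1 (h2 j h6 h3)
  · rintro ⟨h1, h2⟩
    have hn := (dy_val h1).order_unique h2.1
    refine ⟨h1, fun i hi h3 => (lt_iff_val (h1.drop i) h1).2 ?_, hn⟩
    have h4 := iterate_val_degree (α := α.take i) (β := α.drop i) (by rwa [List.take_append_drop])
    have h5 := congrArg degree (List.take_append_drop i α)
    rw [degree_append] at h5
    rw [List.take_append_drop] at h4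
    rw [← h4]
    refine h2.2 _ ?_ (by omega)
    have h6 : α.take i ≠ [] := by
      intro h
      have := congrArg List.length h
      rw [List.length_take, List.length_nil] at this
      omega
    obtain ⟨b, l, hb⟩ := List.exists_cons_of_ne_nil h6
    have := h1.take i
    rw [hb, pos_cons] at this
    rw [hb, degree_cons]
    omega

/-! ### Products -/

theorem val_append (α β : Sequence) :
    val (α ++ β) = val α + (-1) ^ α.length * (val β - 1 / 2) / 2 ^ degree α := by
  induction α with
  | nil => simp [val, degree_nil]
  | cons a α ih =>
    rw [List.cons_append, val, val, ih, degree_cons, List.length_cons, pow_add, pow_succ]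
    field_simp
    ring

theorem val_append_one (α β : Sequence) :
    val (α ++ [1] ++ β) = val α + (-1) ^ α.length * (1 - val β) / 2 ^ (1 + degree α) := by
  rw [List.append_assoc, val_append, List.singleton_append, val, pow_add]
  field_simp
  ring

theorem val_incrLast {α : Sequence} (h : α ≠ []) (β : Sequence) :
    val (incrLast α ++ β) = val α - (-1) ^ α.length * (1 - val β) / 2 ^ (1 + degree α) := by
  obtain ⟨α, a, rfl⟩ := (List.eq_nil_or_concat' α).resolve_left h
  have e : incrLast (α ++ [a]) = α ++ [a + 1] := by simp [incrLast]
  rw [e, List.append_assoc, val_append, val_append α [a], List.singleton_append, val, val, val,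
    List.length_append, List.length_singleton, degree_append, degree_cons, degree_nil, pow_succ,
    pow_add, pow_add, pow_add]
  field_simp
  ring

/-- Each R reverses orientation, so appending 1 or raising the last entry grafts on a side that
depends on the parity of the length. The even completion is the one that always grafts on the left,
the odd one on the right. -/
theorem val_seqE {α : Sequence} (h : α ≠ []) (β : Sequence) :
    val (seqE α ++ β) = val α - (1 - val β) / 2 ^ (1 + degree α) := by
  unfold seqE
  split_ifs with he
  · rw [val_incrLast h, he.neg_one_pow]; ring
  · rw [val_append_one, (Nat.not_even_iff_odd.1 he).neg_one_pow]; ring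

theorem val_seqO (α β : Sequence) :
    val (seqO α ++ β) = val α + (1 - val β) / 2 ^ (1 + degree α) := by
  unfold seqO
  split_ifs with he
  · rw [val_append_one, he.neg_one_pow]; ring
  · rw [val_incrLast (by rintro rfl; exact he Even.zero),
      (Nat.not_even_iff_odd.1 he).neg_one_pow]; ring

theorem Pos.incrLast {α : Sequence} (h : Pos α) : Pos (incrLast α) := by
  refine pos_append.2 ⟨fun x hx => h x (List.mem_of_mem_dropLast hx), ?_⟩
  exact pos_cons.2 ⟨Nat.succ_pos _, Pos.nil⟩

theorem Pos.append_one {α : Sequence} (h : Pos α) : Pos (α ++ [1]) :=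
  pos_append.2 ⟨h, pos_cons.2 ⟨Nat.one_pos, Pos.nil⟩⟩

theorem Pos.seqE {α : Sequence} (h : Pos α) : Pos (seqE α) := by
  unfold LexSeq.seqE
  split_ifs
  exacts [h.incrLast, h.append_one]

theorem Pos.seqO {α : Sequence} (h : Pos α) : Pos (seqO α) := by
  unfold LexSeq.seqO
  split_ifs
  exacts [h.append_one, h.incrLast]

theorem Pos.seqE_append {α β : Sequence} (h : Pos α) (h' : Pos β) : Pos (LexSeq.seqE α ++ β) :=
  pos_append.2 ⟨h.seqE, h'⟩

theorem Pos.seqO_append {α β : Sequence} (h : Pos α) (h' : Pos β) : Pos (LexSeq.seqO α ++ β) :=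
  pos_append.2 ⟨h.seqO, h'⟩

theorem img_replicate {α β : Sequence} (h : α ≠ []) {k : ℕ} {y : ℚ}
    (hβ : Img (val α) (1 + degree α) k y (val β)) (j : ℕ) :
    Img (val α) (1 + degree α) (k + j) (y / 2 ^ j)
      (val ((List.replicate j (seqE α)).flatten ++ β)) := by
  induction j with
  | zero => simpa using hβ
  | succ j ih =>
    rw [List.replicate_succ, List.flatten_cons, List.append_assoc, val_seqE h, pow_succ, ← div_div]
    exact ih.left

theorem pos_replicate {α : Sequence} (h : Pos α) (j : ℕ) :
    Pos (List.replicate j (seqE α)).flatten := by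
  intro x hx
  obtain ⟨l, hl, hx⟩ := List.mem_flatten.1 hx
  rw [List.eq_of_mem_replicate hl] at hx
  exact h.seqE x hx

theorem Pos.star {α β : Sequence} (hα : Pos α) (hβ : Pos β) : Pos (star α β) := by
  unfold LexSeq.star
  split_ifs
  · exact hβ
  · refine pos_append.2 ⟨fun x hx => ?_, hα⟩
    obtain ⟨b, -, hx⟩ := List.mem_flatMap.1 hx
    exact (hα.seqO_append (pos_replicate hα _)) x hx

/-- Each factor α_e is a left graft and each α_o a right graft, so the product repeats the itinerary
of β with blocks based on α. -/
theorem star_img {α β : Sequence} (hα : Pos α) (hβ : Pos β) :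
    Img (val α) (1 + degree α) (1 + degree β) (val β) (val (star α β)) := by
  by_cases h : α = []
  · subst h
    rw [star, if_pos rfl, degree_nil, val]
    exact Img.half (dy_val hβ)
  induction β with
  | nil =>
    rw [star, if_neg h]
    exact .base
  | cons b β ih =>
    rw [pos_cons] at hβ
    have h1 := ih hβ.2
    rw [star, if_neg h] at h1 ⊢
    rw [List.flatMap_cons, List.append_assoc, List.append_assoc, val_seqO]
    have h2 := (img_replicate h h1 (b - 1)).right
    rw [div_div, ← pow_succ, Nat.sub_add_cancel hβ.1] at h2
    rw [degree_cons, val]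
    convert h2 using 1
    omega

theorem Pos.harmonic {α : Sequence} (h : Pos α) (j : ℕ) : Pos (harmonic α j) := by
  induction j with
  | zero => exact h
  | succ j ih => exact ih.seqO_append ih

theorem harmonic_img {α : Sequence} (h : Pos α) (j : ℕ) :
    Img (val α) (1 + degree α) (2 ^ j) (harm j) (val (harmonic α j)) := by
  induction j with
  | zero => exact .base
  | succ j ih =>
    have h1 := (ih.graft ih).2
    rw [← ih.order_eq (dy_val h) (dy_val (h.harmonic j)), ← val_seqO, ← two_mul, ← pow_succ'] at h1
    exact h1

/-! ### The least sequence -/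

/-- Renormalizing at `harm (l + 1)` is renormalizing at `harm l` and then at 3/4, so the doubling
step is applied l times. -/
theorem isLeastMx_mul {l o : ℕ} {y x : ℚ} (hy : IsLeastMx o y) (hx : Img (harm l) (2 ^ l) o y x) :
    IsLeastMx (o * 2 ^ l) x := by
  induction l generalizing x with
  | zero =>
    obtain rfl := hx.unique (Img.half hy.1.1)
    rwa [pow_zero, mul_one]
  | succ l ih =>
    obtain ⟨w, hw⟩ := Img.exists_of_dy (harm l) (2 ^ l) hy.1.1
    obtain ⟨v, h1, h2⟩ := (harm_img l).comp hw
    rw [← pow_succ] at h2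
    obtain rfl := hx.unique h2
    rw [pow_succ, ← mul_assoc]
    exact ((ih hw).double h1).1

theorem val_replicate_one (q : ℕ) : val (List.replicate q 1) = alt q := by
  induction q with
  | zero => rw [alt_zero]; rfl
  | succ q ih => rw [List.replicate_succ, val, ih, alt_succ, pow_one]

theorem eq_two_pow_expTwo_mul {n : ℕ} (hn : 1 ≤ n) : n = (2 * oddHalf n + 1) * 2 ^ expTwo n := by
  have h1 : 2 ^ expTwo n ∣ n := pow_padicValNat_dvd
  have h2 : ¬ 2 ∣ n / 2 ^ expTwo n := by
    intro h
    have h3 : 2 ^ (padicValNat 2 n + 1) ∣ n := by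
      rw [pow_succ]
      exact Nat.mul_dvd_of_dvd_div h1 h
    exact pow_succ_padicValNat_not_dvd (by omega) h3
  have h3 : 2 * oddHalf n + 1 = n / 2 ^ expTwo n := by
    unfold oddHalf
    generalize n / 2 ^ expTwo n = q at *
    omega
  rw [h3, Nat.div_mul_cancel h1]

theorem pos_leastSeq (n : ℕ) : Pos (leastSeq n) := by
  unfold leastSeq
  split_ifs
  · exact Pos.nil.harmonic _
  · refine (Pos.nil.harmonic _).star (pos_cons.2 ⟨by norm_num, fun x hx => ?_⟩)
    rw [List.eq_of_mem_replicate hx]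
    exact one_pos

theorem val_harmonic_nil (j : ℕ) : val (harmonic [] j) = harm j :=
  (harmonic_img Pos.nil j).unique (Img.half (mx_harm j).1)

theorem isLeastMx_leastSeq {n : ℕ} (hn : 1 ≤ n) : IsLeastMx n (val (leastSeq n)) := by
  have hne := eq_two_pow_expTwo_mul hn
  unfold leastSeq
  split_ifs with h
  · rw [h] at hne
    have h1 := isLeastMx_mul (l := expTwo n) isLeastMx_one .base
    rw [val_harmonic_nil]
    rwa [mul_zero, zero_add, ← hne] at *
  · obtain ⟨s, hs⟩ : ∃ s, oddHalf n = s + 1 := ⟨oddHalf n - 1, by omega⟩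
    have hp := pos_leastSeq n
    rw [leastSeq, if_neg h] at hp
    have h1 : Pos (2 :: List.replicate (2 * oddHalf n - 2) 1) := by
      refine pos_cons.2 ⟨by norm_num, fun x hx => ?_⟩
      rw [List.eq_of_mem_replicate hx]
      exact one_pos
    have h2 := star_img (Pos.nil.harmonic (expTwo n)) h1
    -- With `oddHalf n = s + 1`, the sequence (2, 1, …, 1) codes R L R^(2s) C, the least point of
    -- order 2s + 3, the odd part of n.
    have h3 : val (2 :: List.replicate (2 * oddHalf n - 2) 1) = zig (2 * s) := by
      rw [val, val_replicate_one, hs, zig, show 2 * (s + 1) - 2 = 2 * s by omega]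
      norm_num
    have h4 := isLeastMx_zig (even_two_mul s)
    have h5 : 1 + degree (2 :: List.replicate (2 * oddHalf n - 2) 1) = 2 * s + 3 := by
      have := dy_val h1
      rw [h3] at this
      exact this.order_unique h4.1.1
    have h6 : 1 + degree (harmonic [] (expTwo n)) = 2 ^ expTwo n := by
      have := dy_val (Pos.nil.harmonic (expTwo n))
      rw [val_harmonic_nil] at this
      exact this.order_unique (mx_harm _).1
    rw [h3, h5, h6, val_harmonic_nil] at h2
    have h7 := isLeastMx_mul h4 h2
    rwa [show 2 * s + 3 = 2 * oddHalf n + 1 by omega, ← hne] at h7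

/-! ### One step of the procedure -/

theorem mem_D_iff {n : ℕ} {α : Sequence} : α ∈ D n ↔ ∃ d, d ∣ n ∧ α ∈ L d := by
  simp [D]

theorem wedge_append (α β γ : Sequence) : wedge (α ++ β) (α ++ γ) = α ++ wedge β γ := by
  induction α with
  | nil => rfl
  | cons a α ih => rw [List.cons_append, List.cons_append, wedge, if_pos rfl, ih, List.cons_append]

/-- One completion ends in a + 1 and the other in a, 1, so they first differ at the last entry a of
f, which is the smaller one. -/
theorem wedge_seqE_seqO {f : Sequence} (hf : f ≠ []) (g : Sequence) :
    wedge (seqE f ++ g) (seqO f ++ g) = f := by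
  obtain ⟨l, a, rfl⟩ := (List.eq_nil_or_concat' f).resolve_left hf
  have e : incrLast (l ++ [a]) = l ++ [a + 1] := by simp [incrLast]
  have h1 : wedge ((a + 1) :: g) (a :: 1 :: g) = [a] := by
    rw [wedge, if_neg (by omega), min_eq_right (by omega)]
  have h2 : wedge (a :: 1 :: g) ((a + 1) :: g) = [a] := by
    rw [wedge, if_neg (by omega), min_eq_left (by omega)]
  unfold seqE seqO
  split_ifs
  · rw [e, List.append_assoc, List.append_assoc, List.append_assoc, wedge_append]
    exact congrArg _ h1
  · rw [e, List.append_assoc, List.append_assoc, List.append_assoc, wedge_append]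
    exact congrArg _ h2

/-- An elementary operation on an even cell replaces an even completion by the odd one. -/
theorem exists_elemOp_eq {α : Sequence} (h : Pos α) {i : ℕ} (h0 : 0 < i) (hi : Even i)
    (hle : i ≤ α.length) :
    ∃ q, Pos q ∧ q ≠ [] ∧ seqE q = α.take i ∧ elemOp α i = seqO q ++ α.drop i := by
  obtain ⟨i, rfl⟩ := Nat.exists_eq_add_of_le' h0
  have hlt : i < α.length := by omega
  have hv : 0 < α[i] := h _ (List.getElem_mem hlt)
  have ht : α.take (i + 1) = α.take i ++ [α[i]] := by rw [List.take_add_one]; simp [hlt]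
  have hlen : (α.take i).length = i := by rw [List.length_take]; omega
  have hg : α.getD i 0 = α[i] := by simp [hlt]
  have hio : ¬ Even i := by
    rw [Nat.even_add_one] at hi; exact hi
  unfold elemOp
  simp only [Nat.add_sub_cancel, hg, if_pos hi]
  split_ifs with hv1
  · refine ⟨_, pos_append.2 ⟨h.take i, pos_cons.2 ⟨by omega, Pos.nil⟩⟩, by simp, ?_, rfl⟩
    have he : Even (α.take i ++ [α[i] - 1]).length := by
      rw [List.length_append, hlen]; exact hi
    rw [seqE, if_pos he, ht]
    simp only [incrLast, List.dropLast_concat, List.getLastD_concat]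
    rw [Nat.sub_add_cancel hv]
  · refine ⟨_, h.take i, ?_, ?_, rfl⟩
    · intro hc
      rw [hc] at hlen
      obtain rfl : i = 0 := by rw [← hlen]; rfl
      exact hio Even.zero
    · rw [seqE, if_neg (by rwa [hlen]), ht, show α[i] = 1 by omega]

theorem degree_seqE {q : Sequence} (h : Pos q) (hq : q ≠ []) : degree (seqE q) = 1 + degree q := by
  have h1 := dy_val h.seqE
  have h2 := val_seqE hq []
  rw [List.append_nil] at h2
  have h3 := ((dy_val h).graft Dy.base).1
  rw [h2] at h1
  have h4 := h1.order_unique h3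
  omega

theorem mem_evenCells {α : Sequence} {i : ℕ} : i ∈ evenCells α ↔ i ≤ α.length ∧ 0 < i ∧ Even i := by
  simp [evenCells]

theorem pairwise_evenCells (α : Sequence) : (evenCells α).Pairwise (fun i j => j < i) := by
  refine List.Pairwise.filter _ ?_
  rw [List.pairwise_reverse]
  exact List.pairwise_lt_range

/-- The first applicable operation. -/
theorem nextOp_eq_some {n : ℕ} {α α' : Sequence} {i : ℕ} (hi : i ∈ evenCells α)
    (hop : elemOp α i = α') (h : α' ∈ L n ∧ Lt α α')
    (hlong : ∀ j ∈ evenCells α, i < j → ¬ (elemOp α j ∈ L n ∧ Lt α (elemOp α j))) :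
    nextOp n α = some α' := by
  obtain ⟨s, t, hst⟩ := List.append_of_mem hi
  have hp := pairwise_evenCells α
  rw [hst] at hp hlong
  rw [nextOp, hst, List.map_append, List.map_cons, hop, List.find?_append, List.find?_eq_none.2,
    Option.none_or, List.find?_cons_of_pos (by simpa using h)]
  intro x hx
  obtain ⟨j, hj, rfl⟩ := List.mem_map.1 hx
  have h1 := (List.pairwise_append.1 hp).2.2 j hj i List.mem_cons_self
  simpa using hlong j (List.mem_append_left _ hj) h1

theorem val_maxSeq {n : ℕ} (hn : 1 ≤ n) : Pos (maxSeq n) ∧ val (maxSeq n) = 1 - 1 / 2 ^ n := by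
  unfold maxSeq
  split_ifs with h
  · subst h; exact ⟨Pos.nil, by norm_num [val]⟩
  · refine ⟨pos_cons.2 ⟨by omega, Pos.nil⟩, ?_⟩
    obtain ⟨k, rfl⟩ := Nat.exists_eq_add_of_le' hn
    rw [val, val, Nat.add_sub_cancel, pow_succ]
    field_simp

/-- The properties of the stage which follows the sequence `α` (or which starts the listing):
it consists of the next elements of `D n`, up to the next element of `L n`. -/
structure IsNextStage (n : ℕ) (P : Sequence → Prop) (st : Stage) : Prop where
  mem : st.2 ∈ L n
  after : P st.2
  least : ∀ β ∈ L n, P β → β ≠ st.2 → Lt st.2 β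
  inserted : ∀ β, β ∈ st.1 ↔ β ∈ D n ∧ P β ∧ Lt β st.2
  sorted : st.1.Pairwise Lt

theorem val_harmonic_strictMono {f : Sequence} (hf : Pos f) :
    StrictMono fun j => val (harmonic f j) := fun i j h =>
  ((harmonic_img hf i).lt_iff_lt (harmonic_img hf j) (dy_val hf)).1 (harm_strictMono h)

theorem val_star_leastSeq {f : Sequence} (hf : Pos f) {d : ℕ} (hd : 1 ≤ d) :
    Img (val f) (1 + degree f) d (val (leastSeq d)) (val (star f (leastSeq d))) := by
  have h := star_img hf (pos_leastSeq d)
  rwa [(dy_val (pos_leastSeq d)).order_unique (isLeastMx_leastSeq hd).1.1] at h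

theorem two_pow_dvd_iff {d j : ℕ} (hd : 1 ≤ d) : 2 ^ j ∣ d ↔ j ≤ expTwo d :=
  padicValNat_dvd_iff_le (by omega)

theorem pairwise_harmonicStage {f : Sequence} (hf : Pos f) (d : ℕ) :
    (harmonicStage f d).1.Pairwise Lt := by
  refine List.Pairwise.filter _ ?_
  rw [List.pairwise_map]
  refine List.pairwise_lt_range.imp fun {i j} h => ?_
  exact (lt_iff_val (hf.harmonic i) (hf.harmonic j)).2 (val_harmonic_strictMono hf h)

theorem mem_harmonicStage {f : Sequence} (hf : Pos f) {d : ℕ} (hd : 1 ≤ d) {β : Sequence} :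
    β ∈ (harmonicStage f d).1 ↔
      ∃ j, 2 ^ j ∣ d ∧ β = harmonic f j ∧ val β < val (star f (leastSeq d)) := by
  have hs := hf.star (pos_leastSeq d)
  have hle : ∀ j, 2 ^ j ∣ d → val (harmonic f j) ≤ val (star f (leastSeq d)) := fun j hj =>
    ((harmonic_img hf j).le_iff_le (val_star_leastSeq hf hd) (dy_val hf)).1
      ((isLeastMx_leastSeq hd).harm_le hj)
  simp only [harmonicStage, List.mem_filter, List.mem_map, List.mem_range, Nat.lt_succ_iff,
    ← two_pow_dvd_iff hd, decide_eq_true_eq]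
  constructor
  · rintro ⟨⟨j, hj, rfl⟩, hne⟩
    exact ⟨j, hj, rfl, lt_of_le_of_ne (hle j hj) fun e => hne (val_injective (hf.harmonic j) hs e)⟩
  · rintro ⟨j, hj, rfl, hlt⟩
    exact ⟨⟨j, hj, rfl⟩, fun e => hlt.ne (by rw [e])⟩

theorem isNextStage_start {n : ℕ} (hn : 1 ≤ n) :
    IsNextStage n (fun _ => True) (harmonicStage [] n) := by
  have hl := isLeastMx_leastSeq hn
  have hp := pos_leastSeq n
  have hs : star [] (leastSeq n) = leastSeq n := if_pos rfl
  refine ⟨?_, trivial, fun β hβ _ hne => ?_, fun β => ?_, pairwise_harmonicStage Pos.nil n⟩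
  · change star [] (leastSeq n) ∈ L n
    rw [hs]
    exact mem_L_iff.2 ⟨hp, hl.1⟩
  · change Lt (star [] (leastSeq n)) β
    change β ≠ star [] (leastSeq n) at hne
    rw [hs] at hne ⊢
    obtain ⟨h1, h2⟩ := mem_L_iff.1 hβ
    exact (lt_iff_val hp h1).2 (lt_of_le_of_ne (hl.2 _ h2) fun e => hne (val_injective hp h1 e).symm)
  · rw [mem_harmonicStage Pos.nil hn]
    change _ ↔ _ ∧ _ ∧ Lt β (star [] (leastSeq n))
    rw [hs]
    constructor
    · rintro ⟨j, hj, rfl, hlt⟩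
      have hh := Pos.nil.harmonic j
      exact ⟨mem_D_iff.2 ⟨2 ^ j, hj, mem_L_iff.2 ⟨hh, by rw [val_harmonic_nil]; exact mx_harm j⟩⟩,
        trivial, (lt_iff_val hh hp).2 hlt⟩
    · rintro ⟨hD, -, hlt⟩
      obtain ⟨c, hc, hL⟩ := mem_D_iff.1 hD
      obtain ⟨h1, h2⟩ := mem_L_iff.1 hL
      have hlt' := (lt_iff_val h1 hp).1 hlt
      rcases hl.eq_or_eq_harm h2 hc hlt'.le with h3 | ⟨j, hj, h3⟩
      · exact absurd h3 hlt'.ne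
      · rw [← val_harmonic_nil] at h3
        exact ⟨j, hj, val_injective h1 (Pos.nil.harmonic j) h3, hlt'⟩

/-- One step of the procedure, at an element which is not the last one. -/
theorem exists_step {n : ℕ} {α : Sequence} (hα : α ∈ L n) (hne : α ≠ maxSeq n) :
    ∃ α' f, nextOp n α = some α' ∧ f = wedge α α' ∧ f ∈ L (1 + degree f) ∧
      IsNextStage n (Lt α) (nextStage n f α') := by
  obtain ⟨hpα, hmx⟩ := mem_L_iff.1 hα
  have hn := hmx.1.pos_order
  have htop := val_maxSeq hn
  obtain ⟨b, hb, hab, hbm⟩ := exists_mx_succ (n := n) (p := val α) ⟨_, mx_top hn,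
    lt_of_le_of_ne (hmx.1.le_top le_rfl) fun e =>
      hne (val_injective hpα htop.1 (e.trans htop.2.symm))⟩
  obtain ⟨m, p, G⟩ := exists_gap hmx hb hab fun x hx h1 h2 => absurd (hbm x hx h1) (not_le.2 h2)
  obtain ⟨f, hf, rfl, rfl⟩ := exists_val_eq G.mid (by linarith [hmx.half_le, G.lt_mid])
  -- Since T^m a ≥ 1/2, the tail of the itinerary is coded by a sequence g, and α = f_e g.
  obtain ⟨g, hg, hgv, -⟩ := exists_val_eq (hmx.1.iterate G.order_lt) G.half_le_iterate
  have hf0 : f ≠ [] := by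
    rintro rfl
    have := G.two_le_order
    rw [degree_nil] at this
    omega
  have hae := G.left_eq
  rw [← hgv] at hae
  have hαe : α = seqE f ++ g :=
    val_injective hpα (hf.seqE_append hg) (by rw [val_seqE hf0]; exact hae)
  have hpos' := hf.seqO_append hg
  have hval' : val (seqO f ++ g) = 2 * val f - val α := by
    rw [val_seqO]; linarith
  have hL' : seqO f ++ g ∈ L n := mem_L_iff.2 ⟨hpos', by rw [hval']; exact G.mirror_mx⟩
  have hlt' : Lt α (seqO f ++ g) := by
    rw [lt_iff_val hpα hpos', hval']; linarith [G.lt_mid]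
  have hfL : f ∈ L (1 + degree f) := mem_L_iff.2 ⟨hf, G.mx_mid⟩
  have hcell : (seqE f).length ∈ evenCells α := by
    rw [mem_evenCells]
    have : Even (seqE f).length := by
      unfold seqE incrLast
      split_ifs with h
      · have : f.length ≠ 0 := fun h => hf0 (List.length_eq_zero_iff.1 h)
        rwa [List.length_append, List.length_dropLast, List.length_singleton,
          Nat.sub_add_cancel (by omega)]
      · rw [List.length_append, List.length_singleton, Nat.even_add_one]; exact h
    refine ⟨by rw [hαe, List.length_append]; omega, List.length_pos_of_ne_nil ?_, this⟩
    intro h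
    have := degree_seqE hf hf0
    rw [h, degree_nil] at this
    omega
  have hop : elemOp α (seqE f).length = seqO f ++ g := by
    obtain ⟨h1, h2, h3⟩ := mem_evenCells.1 hcell
    obtain ⟨q, hq, hq0, hqe, hqo⟩ := exists_elemOp_eq hpα h2 h3 h1
    have e1 : α.take (seqE f).length = seqE f := by rw [hαe, List.take_left]
    have e2 : α.drop (seqE f).length = g := by rw [hαe, List.drop_left]
    rw [hqo, e2]
    -- q_e = f_e forces q = f: the orders agree, and then so do the values.
    have e3 := degree_seqE hq hq0
    rw [hqe, e1, degree_seqE hf hf0] at e3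
    have e4 := val_seqE hq0 []
    rw [hqe, e1, val_seqE hf0, e3] at e4
    rw [val_injective hq hf (by linarith)]
  have hnext : nextOp n α = some (seqO f ++ g) := by
    refine nextOp_eq_some hcell hop ⟨hL', hlt'⟩ ?_
    rintro j hj hij ⟨hjL, hjlt⟩
    obtain ⟨h1, h2, h3⟩ := mem_evenCells.1 hj
    obtain ⟨q, hq, hq0, hqe, hqo⟩ := exists_elemOp_eq hpα h2 h3 h1
    rw [hqo] at hjL hjlt
    have hpd := hpα.drop j
    have e1 := val_seqE hq0 (α.drop j)
    rw [hqe, List.take_append_drop] at e1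
    have e2 := val_seqO q (α.drop j)
    obtain ⟨hpx, hmxx⟩ := mem_L_iff.1 hjL
    have hbx := G.right_le hmxx ((lt_iff_val hpα hpx).1 hjlt)
    have hord : 1 + degree f < 1 + degree q := by
      rw [← degree_seqE hf hf0, ← degree_seqE hq hq0, hqe, hαe, List.take_append,
        List.take_of_length_le hij.le, degree_append]
      have hlen : 0 < (g.take (j - (seqE f).length)).length := by
        rw [List.length_take]
        rw [hαe, List.length_append] at h1
        omega
      obtain ⟨c, l, hcl⟩ := List.exists_cons_of_length_pos hlen
      have := hg.take (j - (seqE f).length)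
      rw [hcl, pos_cons] at this
      rw [hcl, degree_cons]
      omega
    -- The operation on cell j reflects α in `val q` at a distance below 2^-(1 + D(q)), so `val f`,
    -- which lies between α and the result, is closer to `val q` than separation allows.
    have hsep := (dy_val hq).sep (dy_val hf) hord.le
      ((dy_val hf).ne_of_order (dy_val hq) (by omega))
    have hv : (1 - val (α.drop j)) / 2 ^ (1 + degree q) < 1 / 2 ^ (1 + degree q) := by
      gcongr
      linarith [half_le_val hpd]
    have h4 := G.lt_mid
    have h5 := G.mid_lt
    rcases abs_choice (val f - val q) with h | h <;> rw [h] at hsep <;> linarith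
  refine ⟨_, f, hnext, ?_, hfL, ?_⟩
  · rw [hαe, wedge_seqE_seqO hf0 g]
  have hbetween : ∀ {γ : Sequence}, Pos γ → val γ = b → γ ∈ L n ∧ Lt α γ ∧
      ∀ β ∈ L n, Lt α β → β ≠ γ → Lt γ β := by
    rintro γ hγ rfl
    refine ⟨mem_L_iff.2 ⟨hγ, hb⟩, (lt_iff_val hpα hγ).2 hab, fun β hβ h1 h2 => ?_⟩
    obtain ⟨h3, h4⟩ := mem_L_iff.1 hβ
    exact (lt_iff_val hγ h3).2 (lt_of_le_of_ne (G.right_le h4 ((lt_iff_val hpα h3).1 h1))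
      fun e => h2 (val_injective hγ h3 e).symm)
  unfold nextStage
  split_ifs with hr
  · have hnd : ¬ (1 + degree f) ∣ n := fun h => hr.ne' (Nat.mod_eq_zero_of_dvd h)
    have hvb : val (seqO f ++ g) = b := hval'.trans (G.symm hnd)
    obtain ⟨h1, h2, h3⟩ := hbetween hpos' hvb
    refine ⟨h1, h2, h3, fun β => ?_, List.Pairwise.nil⟩
    refine ⟨fun h => absurd h List.not_mem_nil, ?_⟩
    rintro ⟨hD, h4, h5⟩
    obtain ⟨c, hc, hL⟩ := mem_D_iff.1 hD
    obtain ⟨h6, h7⟩ := mem_L_iff.1 hL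
    exact absurd (G.dvd_of_mem h7 hc ((lt_iff_val hpα h6).1 h4)
      (hvb ▸ (lt_iff_val h6 hpos').1 h5)) hnd
  · have hdvd : (1 + degree f) ∣ n := Nat.dvd_of_mod_eq_zero (by omega)
    have hd := (Nat.div_mul_cancel hdvd).symm
    set d := n / (1 + degree f)
    have hd1 : 1 ≤ d := Nat.pos_of_ne_zero fun h => by rw [h] at hd; omega
    have hps := hf.star (pos_leastSeq d)
    have hvb : val (star f (leastSeq d)) = b :=
      (val_star_leastSeq hf hd1).unique (G.right_img hd (isLeastMx_leastSeq hd1))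
    obtain ⟨h1, h2, h3⟩ := hbetween hps hvb
    refine ⟨h1, h2, h3, fun β => ?_, pairwise_harmonicStage hf d⟩
    rw [mem_harmonicStage hf hd1]
    constructor
    · rintro ⟨j, hj, rfl, hlt⟩
      have hh := hf.harmonic j
      have himg := harmonic_img hf j
      refine ⟨mem_D_iff.2 ⟨2 ^ j * (1 + degree f), by rw [hd]; exact Nat.mul_dvd_mul_right hj _,
        mem_L_iff.2 ⟨hh, (himg.mx_iff G.mx_mid).1 (mx_harm j)⟩⟩, ?_, (lt_iff_val hh hps).2 hlt⟩
      rw [lt_iff_val hpα hh]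
      exact G.lt_mid.trans_le ((Img.base.le_iff_le himg G.mid).1 (mx_harm j).half_le)
    · rintro ⟨hD, h4, h5⟩
      obtain ⟨c, hc, hL⟩ := mem_D_iff.1 hD
      obtain ⟨h6, h7⟩ := mem_L_iff.1 hL
      have h8 := (lt_iff_val h6 hps).1 h5
      obtain ⟨j, hj, himg⟩ := G.exists_harm_img hd h7 hc ((lt_iff_val hpα h6).1 h4) (hvb ▸ h8)
      exact ⟨j, hj, val_injective h6 (hf.harmonic j) (himg.unique (harmonic_img hf j)), h8⟩

/-! ### The complete listing -/

theorem RunFrom.unique {n : ℕ} {α : Sequence} {ss ss' : List Stage} (h : RunFrom n α ss)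
    (h' : RunFrom n α ss') : ss = ss' := by
  induction h generalizing ss' with
  | done =>
    generalize hα : maxSeq n = α at h'
    cases h' with
    | done => rfl
    | step _ _ _ _ hne => exact absurd hα.symm hne
  | step α α' f ss hne hop hf hfL hrest ih =>
    subst hf
    cases h' with
    | done => exact absurd rfl hne
    | step _ β f' ss' _ hop' hf' _ hrest' =>
      subst hf'
      obtain rfl := Option.some.inj (hop.symm.trans hop')
      rw [ih hrest']

theorem pos_of_mem_L {n : ℕ} {α : Sequence} (h : α ∈ L n) : Pos α := h.1

theorem pos_of_mem_D {n : ℕ} {α : Sequence} (h : α ∈ D n) : Pos α := by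
  obtain ⟨d, -, h⟩ := mem_D_iff.1 h
  exact h.1

theorem L_subset_D {n : ℕ} {α : Sequence} (h : α ∈ L n) : α ∈ D n := mem_D_iff.2 ⟨n, dvd_rfl, h⟩

theorem Lt.trans' {α β γ : Sequence} (hα : Pos α) (hβ : Pos β) (hγ : Pos γ) (h : Lt α β)
    (h' : Lt β γ) : Lt α γ :=
  (lt_iff_val hα hγ).2 (((lt_iff_val hα hβ).1 h).trans ((lt_iff_val hβ hγ).1 h'))

theorem lt_trichotomy' {α β : Sequence} (hα : Pos α) (hβ : Pos β) : Lt α β ∨ α = β ∨ Lt β α := by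
  rcases lt_trichotomy (val α) (val β) with h | h | h
  · exact .inl ((lt_iff_val hα hβ).2 h)
  · exact .inr (.inl (val_injective hα hβ h))
  · exact .inr (.inr ((lt_iff_val hβ hα).2 h))

/-- The stages `ss` list, in increasing order, the elements of `D n` and of `L n` with the
property `P`. -/
structure Lists (n : ℕ) (P : Sequence → Prop) (ss : List Stage) : Prop where
  mem_output : ∀ β, β ∈ output ss ↔ β ∈ D n ∧ P β
  sorted_output : (output ss).Pairwise Lt
  mem_main : ∀ β, β ∈ mainElements ss ↔ β ∈ L n ∧ P β
  sorted_main : (mainElements ss).Pairwise Lt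

theorem Lists.cons {n : ℕ} {P : Sequence → Prop} {st : Stage} {ss : List Stage}
    (hst : IsNextStage n P st) (hP : ∀ β, Pos β → Lt st.2 β → P β) (hss : Lists n (Lt st.2) ss) :
    Lists n P (st :: ss) := by
  have e : output (st :: ss) = st.1 ++ st.2 :: output ss := by simp [output]
  have hp := pos_of_mem_L hst.mem
  refine ⟨fun β => ?_, ?_, fun β => ?_, ?_⟩
  · rw [e, List.mem_append, List.mem_cons, hst.inserted, hss.mem_output]
    constructor
    · rintro (⟨h1, h2, -⟩ | rfl | ⟨h1, h2⟩)
      · exact ⟨h1, h2⟩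
      · exact ⟨L_subset_D hst.mem, hst.after⟩
      · exact ⟨h1, hP _ (pos_of_mem_D h1) h2⟩
    · rintro ⟨h1, h2⟩
      rcases lt_trichotomy' (pos_of_mem_D h1) hp with h | h | h
      · exact .inl ⟨h1, h2, h⟩
      · exact .inr (.inl h)
      · exact .inr (.inr ⟨h1, h⟩)
  · rw [e, List.pairwise_append]
    refine ⟨hst.sorted, List.pairwise_cons.2 ⟨fun β hβ => ((hss.mem_output β).1 hβ).2,
      hss.sorted_output⟩, fun β hβ γ hγ => ?_⟩
    have h1 := (hst.inserted β).1 hβ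
    rcases List.mem_cons.1 hγ with rfl | hγ
    · exact h1.2.2
    · have h2 := (hss.mem_output γ).1 hγ
      exact h1.2.2.trans' (pos_of_mem_D h1.1) hp (pos_of_mem_D h2.1) h2.2
  · rw [mainElements, List.map_cons, List.mem_cons]
    refine ⟨?_, fun ⟨h1, h2⟩ => ?_⟩
    · rintro (rfl | h)
      · exact ⟨hst.mem, hst.after⟩
      · obtain ⟨h1, h2⟩ := (hss.mem_main β).1 h
        exact ⟨h1, hP _ (pos_of_mem_L h1) h2⟩
    · by_cases h : β = st.2
      · exact .inl h
      · exact .inr ((hss.mem_main β).2 ⟨h1, hst.least β h1 h2 h⟩)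
  · rw [mainElements, List.map_cons, List.pairwise_cons]
    exact ⟨fun β hβ => ((hss.mem_main β).1 hβ).2, hss.sorted_main⟩

theorem finite_L (n : ℕ) : (L n).Finite := by
  refine Set.Finite.of_finite_image (f := val) ((Dy.finite n).subset ?_) ?_
  · rintro _ ⟨α, hα, rfl⟩
    exact (mem_L_iff.1 hα).2.1
  · intro α hα β hβ h
    exact val_injective (pos_of_mem_L hα) (pos_of_mem_L hβ) h

/-- Each step reaches the next element of L_n, so the number of elements still above decreases until
(n-1), the greatest element of D_n, is reached. -/
theorem exists_runFrom {n : ℕ} {α : Sequence} (hα : α ∈ L n) :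
    ∃ ss, RunFrom n α ss ∧ Lists n (Lt α) ss := by
  induction hN : {β ∈ L n | Lt α β}.ncard using Nat.strong_induction_on generalizing α with
  | _ N IH =>
  have hp := pos_of_mem_L hα
  by_cases hne : α = maxSeq n
  · subst hne
    have hn := (mem_L_iff.1 hα).2.1.pos_order
    have hno : ∀ β ∈ D n, ¬ Lt (maxSeq n) β := by
      intro β hβ h
      obtain ⟨d, hd, hL⟩ := mem_D_iff.1 hβ
      obtain ⟨h1, h2⟩ := mem_L_iff.1 hL
      have h3 := h2.1.le_top (Nat.le_of_dvd hn hd)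
      rw [lt_iff_val hp h1, (val_maxSeq hn).2] at h
      linarith
    refine ⟨[], .done, fun β => ⟨fun h => absurd h List.not_mem_nil, fun h => (hno β h.1 h.2).elim⟩,
      List.Pairwise.nil, fun β => ⟨fun h => absurd h List.not_mem_nil,
        fun h => (hno β (L_subset_D h.1) h.2).elim⟩, List.Pairwise.nil⟩
  · obtain ⟨α', f, hop, hf, hfL, hst⟩ := exists_step hα hne
    have hp' := pos_of_mem_L hst.mem
    obtain ⟨ss, h1, h2⟩ := IH _ (by
      rw [← hN]
      refine Set.ncard_lt_ncard ?_ ((finite_L n).subset (Set.sep_subset _ _))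
      refine ⟨fun β hβ => ⟨hβ.1, hst.after.trans' hp hp' (pos_of_mem_L hβ.1) hβ.2⟩, fun h => ?_⟩
      have := (h ⟨hst.mem, hst.after⟩).2
      exact this.asymm this) hst.mem rfl
    exact ⟨_, .step α α' f ss hne hop hf hfL h1,
      h2.cons hst fun β hβ h => hst.after.trans' hp hp' hβ h⟩

theorem isChain_adjLt {S : Set Sequence} {l : List Sequence} (hl : l.Pairwise Lt)
    (hmem : ∀ β, β ∈ l ↔ β ∈ S) : l.IsChain (AdjLt S) := by
  rw [List.isChain_iff_getElem]
  rw [List.pairwise_iff_getElem] at hl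
  intro i hi
  refine ⟨(hmem _).1 (List.getElem_mem _), (hmem _).1 (List.getElem_mem _),
    hl _ _ _ _ (Nat.lt_succ_self i), ?_⟩
  rintro ⟨γ, hγ, h1, h2⟩
  obtain ⟨k, hk, rfl⟩ := List.getElem_of_mem ((hmem γ).2 hγ)
  rcases lt_trichotomy i k with h | rfl | h
  · rcases Nat.eq_or_lt_of_le (show i + 1 ≤ k from h) with h3 | h3
    · subst h3
      exact h2.asymm h2
    · exact h2.asymm (hl _ _ _ _ h3)
  · exact h1.asymm h1
  · exact h1.asymm (hl _ _ _ _ h)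

end LexSeq


/-! ### The theorem -/

theorem mainTheorem5 (n : ℕ) (hn : 1 ≤ n) :
    (LexSeq.leastSeq n ∈ LexSeq.L n ∧
      ∀ β ∈ LexSeq.L n, β ≠ LexSeq.leastSeq n → LexSeq.Lt (LexSeq.leastSeq n) β) ∧
    ∃ run : List LexSeq.Stage,
      LexSeq.IsRun n run ∧
      (∀ run' : List LexSeq.Stage, LexSeq.IsRun n run' → run' = run) ∧
      (∀ α : LexSeq.Sequence, α ∈ LexSeq.output run ↔ α ∈ LexSeq.D n) ∧
      (LexSeq.output run).Pairwise LexSeq.Lt ∧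
      (LexSeq.output run).IsChain (LexSeq.AdjLt (LexSeq.D n)) ∧
      (∀ α : LexSeq.Sequence, α ∈ LexSeq.mainElements run ↔ α ∈ LexSeq.L n) ∧
      (LexSeq.mainElements run).Pairwise LexSeq.Lt ∧
      (LexSeq.mainElements run).IsChain (LexSeq.AdjLt (LexSeq.L n)) := by
  have hs : LexSeq.star [] (LexSeq.leastSeq n) = LexSeq.leastSeq n := if_pos rfl
  have hst := LexSeq.isNextStage_start hn
  have hmem : LexSeq.leastSeq n ∈ LexSeq.L n := by
    have := hst.mem
    rwa [LexSeq.harmonicStage, hs] at this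
  have hleast : ∀ β ∈ LexSeq.L n, β ≠ LexSeq.leastSeq n → LexSeq.Lt (LexSeq.leastSeq n) β := by
    intro β hβ hne
    have := hst.least β hβ trivial
    rw [LexSeq.harmonicStage, hs] at this
    exact this hne
  refine ⟨⟨hmem, hleast⟩, ?_⟩
  obtain ⟨ss, h1, h2⟩ := LexSeq.exists_runFrom hmem
  have h3 : LexSeq.Lists n (fun _ => True) (LexSeq.harmonicStage [] n :: ss) :=
    LexSeq.Lists.cons hst (fun _ _ _ => trivial) (by rwa [LexSeq.harmonicStage, hs])
  have h4 : ∀ β, β ∈ LexSeq.output (LexSeq.harmonicStage [] n :: ss) ↔ β ∈ LexSeq.D n :=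
    fun β => (h3.mem_output β).trans (and_iff_left trivial)
  have h5 : ∀ β, β ∈ LexSeq.mainElements (LexSeq.harmonicStage [] n :: ss) ↔ β ∈ LexSeq.L n :=
    fun β => (h3.mem_main β).trans (and_iff_left trivial)
  refine ⟨LexSeq.harmonicStage [] n :: ss, ⟨_, ss, rfl, h1, ?_⟩, ?_, h4, h3.sorted_output,
    LexSeq.isChain_adjLt h3.sorted_output h4, h5, h3.sorted_main,
    LexSeq.isChain_adjLt h3.sorted_main h5⟩
  · rw [LexSeq.harmonicStage, hs]
  · rintro run ⟨start, ss', rfl, h6, rfl⟩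
    rw [h6.unique h1, LexSeq.harmonicStage, hs]
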